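/- **Setting.** Let $G=(X,Y,E)$ be a finite connected bipartite graph with $X=\{x_1,\dots,x_{n_X}\}$ and $Y=\{y_1,\dots,y_{n_Y}\}$ nonempty. Let $G$ be convex: the neighbourhood of each $x\in X$ is an interval $\{y_{left(x)},\dots,y_{right(x)}\}$. Let the numbering be lex-convex: $i<j$ implies $(left(x_i),right(x_i))\le_{lex}(left(x_j),right(x_j))$. A set $D\subseteq X$ is red dominating if every $y\in Y$ has a neighbour in $D$. An MCRD set is a red dominating set of minimum cardinality, and $k$ denotes this minimum. **Algorithm 1 (labels).** Put $Label[x]=0$ for $x\in N(y_1)$ and $Label[x]=\infty$ otherwise, and enqueue $N(y_1)$ in order in a FIFO queue. While the queue is not empty, dequeue $x$, and for every $x'>x$ with $left(x)<left(x')\le right(x)+1\le right(x')$ and $Label[x']\ge Label[x]+1$: enqueue $x'$ if $Label[x']>Label[x]+1$, and set $Label[x']:=Label[x]+1$. **Algorithm 2 (enumeration).** The input is the array of the pairs $(left(x),right(x))$, the array $Label$ and the number $k-1$. For each $x\in N(y_{n_Y})$ with $Label[x]=k-1$, call GENERATE$(\{x\},x)$. The call GENERATE$(D,x)$ outputs $D$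 and returns if $Label[x]=0$; otherwise it calls GENERATE$(D\cup\{x'\},x')$ for each $x'<x$ with $left(x')\le left(x)-1\le right(x')<right(x)$ and $Label[x']=Label[x]-1$, and then returns. The loops may be executed in any order. **Theorem.** There are an absolute constant $C$ and a fixed program $P$ for a random access machine (with registers, arrays, addition, truncated subtraction and comparison at unit cost, where printing $n$ entries costs $n$ units), such that for every such $G$ the following holds. 1. Algorithm 1 terminates, and its labels satisfy $\min_{x\in N(y_{n_Y})}Label[x]=k-1$. 2. Algorithm 2, run with these labels, terminates. For every order of its loops, the sets it outputs are exactly the MCRD sets of $G$, each output once. 3. There are no failed partial solutions: in every run, after each call GENERATE$(D,x)$ and before any call returns, a set containing $D$ is output. 4. In every run there are at most $Ck$ calls and returns before the first output, between any two consecutive outputs, and after the last output. 5. On the input of Algorithm 2, the program $P$ prints the output sequence of a run of Algorithm 2. It writes only to cells with index below $C\,n_X$ in each of its finitely many arrays, every number it stores is at most $C(n_X+n_Y)$, the time before its first output is at most $C(n_X+|E|)$, and the time between any two consecutive outputs, as well as between the last output and termination, is at most $Ck$. Thus the algorithm can be implemented with $O(n_X)$ space and $O(k)$ delay. -/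

import Mathlib

namespace RedDom

/-! ### Convex bipartite graphs in lex-convex numbering

The `X`-vertices are `Sum.inl x` with `x : Fin nX`, the `Y`-vertices are `Sum.inr y` with
`y : Fin nY`; indices start at `0`. -/

/-- `x` is adjacent to the `Y`-vertex with index `j`. -/
def Nbr {nX nY : ℕ} (G : SimpleGraph (Fin nX ⊕ Fin nY)) (x : Fin nX) (j : ℕ) : Prop :=
  ∃ h : j < nY, G.Adj (Sum.inl x) (Sum.inr ⟨j, h⟩)

/-- Index of the leftmost neighbour of `x`. -/
noncomputable def left {nX nY : ℕ} (G : SimpleGraph (Fin nX ⊕ Fin nY)) (x : Fin nX) : ℕ :=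
  sInf {j | Nbr G x j}

/-- Index of the rightmost neighbour of `x`. -/
noncomputable def right {nX nY : ℕ} (G : SimpleGraph (Fin nX ⊕ Fin nY)) (x : Fin nX) : ℕ :=
  sSup {j | Nbr G x j}

/-- A connected convex bipartite graph with both sides nonempty, numbered lex-convexly:
every neighbourhood of an `X`-vertex is an interval of `Y`, and the `X`-vertices are sorted
lexicographically by `(left, right)`, ties being arbitrary. -/
structure IsLexConvex {nX nY : ℕ} (G : SimpleGraph (Fin nX ⊕ Fin nY)) : Prop where
  nonemptyX : 0 < nX
  nonemptyY : 0 < nY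
  connected : G.Connected
  bipartite : G.IsBipartiteWith (Set.range Sum.inl) (Set.range Sum.inr)
  convex : ∀ x : Fin nX, Set.OrdConnected {y : Fin nY | G.Adj (Sum.inl x) (Sum.inr y)}
  lex : ∀ i j : Fin nX, i < j →
    left G i < left G j ∨ (left G i = left G j ∧ right G i ≤ right G j)

/-- `D ⊆ X` dominates `Y`. -/
def IsRedDominating {nX nY : ℕ} (G : SimpleGraph (Fin nX ⊕ Fin nY)) (D : Finset (Fin nX)) :
    Prop :=
  ∀ y : Fin nY, ∃ x ∈ D, G.Adj (Sum.inl x) (Sum.inr y)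

/-- Minimum cardinality red dominating (MCRD) sets. -/
def IsMCRD {nX nY : ℕ} (G : SimpleGraph (Fin nX ⊕ Fin nY)) (D : Finset (Fin nX)) : Prop :=
  IsRedDominating G D ∧ ∀ D' : Finset (Fin nX), IsRedDominating G D' → D.card ≤ D'.card

/-- The minimum cardinality `k` of a red dominating set. -/
noncomputable def mcrdCard {nX nY : ℕ} (G : SimpleGraph (Fin nX ⊕ Fin nY)) : ℕ :=
  sInf {c | ∃ D : Finset (Fin nX), IsRedDominating G D ∧ D.card = c}

/-! ### The labelling algorithm

The array `Count` of the labelling algorithm is not used for enumeration and is left out. -/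

/-- The set over which the inner loop of the labelling algorithm runs when `x` is dequeued,
listed by increasing index. -/
noncomputable def labelTargets {nX nY : ℕ} (G : SimpleGraph (Fin nX ⊕ Fin nY))
    (L : Fin nX → ℕ∞) (x : Fin nX) : List (Fin nX) :=
  open Classical in
  (List.finRange nX).filter fun x' => decide
    (x < x' ∧ left G x < left G x' ∧ left G x' ≤ right G x + 1 ∧ right G x + 1 ≤ right G x' ∧
      L x + 1 ≤ L x')

/-- One pass through the body of the inner loop: the state is the queue and the label array. -/
noncomputable def labelBody {nX : ℕ} (x : Fin nX) (s : List (Fin nX) × (Fin nX → ℕ∞))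
    (xj : Fin nX) : List (Fin nX) × (Fin nX → ℕ∞) :=
  open Classical in
  (if s.2 x + 1 < s.2 xj then s.1 ++ [xj] else s.1, Function.update s.2 xj (s.2 x + 1))

/-- `LabelLoop G Q L L'`: the loop `while the queue is not empty`, started with queue `Q` and
labels `L`, terminates with labels `L'`. -/
inductive LabelLoop {nX nY : ℕ} (G : SimpleGraph (Fin nX ⊕ Fin nY)) :
    List (Fin nX) → (Fin nX → ℕ∞) → (Fin nX → ℕ∞) → Prop
  | done (L : Fin nX → ℕ∞) : LabelLoop G [] L L
  | step (x : Fin nX) (Q : List (Fin nX)) (L L' : Fin nX → ℕ∞)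
      (h : LabelLoop G ((labelTargets G L x).foldl (labelBody x) (Q, L)).1
        ((labelTargets G L x).foldl (labelBody x) (Q, L)).2 L') :
      LabelLoop G (x :: Q) L L'

/-- The labelling algorithm terminates with the array `L`: at the start the neighbours of the
first `Y`-vertex are in the queue, in order, with label `0`, and all other labels are `∞`. -/
def LabelOutput {nX nY : ℕ} (G : SimpleGraph (Fin nX ⊕ Fin nY)) (L : Fin nX → ℕ∞) : Prop :=
  open Classical in
  LabelLoop G ((List.finRange nX).filter fun x => decide (Nbr G x 0))
    (fun x => if Nbr G x 0 then 0 else ⊤) L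

/-! ### The branch-and-bound algorithm -/

/-- What happens in a run: a call `GENERATE(D, x)`, an output, a return from a call. -/
inductive Event (nX : ℕ) : Type
  | call (D : Finset (Fin nX)) (x : Fin nX) : Event nX
  | output (D : Finset (Fin nX)) : Event nX
  | ret : Event nX

/-- `x'` belongs to the set of the loop in `GENERATE(D, x)`:
`x' < x`, `left x' ≤ left x - 1 ≤ right x' < right x` and `Label x' = Label x - 1`,
written without subtraction (it is only used when `Label x ≠ 0`). -/
def Candidate {nX nY : ℕ} (G : SimpleGraph (Fin nX ⊕ Fin nY)) (L : Fin nX → ℕ∞)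
    (x x' : Fin nX) : Prop :=
  x' < x ∧ left G x' + 1 ≤ left G x ∧ left G x ≤ right G x' + 1 ∧ right G x' < right G x ∧
    L x' + 1 = L x

mutual

/-- `Generate G L D x τ`: the call `GENERATE(D, x)` can be executed with event sequence `τ`.
The loop may go through its set in any order, each element exactly once. -/
inductive Generate {nX nY : ℕ} (G : SimpleGraph (Fin nX ⊕ Fin nY)) (L : Fin nX → ℕ∞) :
    Finset (Fin nX) → Fin nX → List (Event nX) → Prop
  | leaf (D : Finset (Fin nX)) (x : Fin nX) (h : L x = 0) :
      Generate G L D x [Event.call D x, Event.output D, Event.ret]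
  | node (D : Finset (Fin nX)) (x : Fin nX) (l : List (Fin nX)) (τ : List (Event nX))
      (h : L x ≠ 0) (hl : l.Nodup) (hmem : ∀ x', x' ∈ l ↔ Candidate G L x x')
      (hloop : GenerateLoop G L D l τ) :
      Generate G L D x (Event.call D x :: (τ ++ [Event.ret]))

/-- `GenerateLoop G L D l τ`: executing `GENERATE(D ∪ {x}, x)` successively for the members `x`
of the list `l`, with the same `D` for each of them, has event sequence `τ`. -/
inductive GenerateLoop {nX nY : ℕ} (G : SimpleGraph (Fin nX ⊕ Fin nY)) (L : Fin nX → ℕ∞) :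
    Finset (Fin nX) → List (Fin nX) → List (Event nX) → Prop
  | nil (D : Finset (Fin nX)) : GenerateLoop G L D [] []
  | cons (D : Finset (Fin nX)) (x : Fin nX) (l : List (Fin nX)) (τ τ' : List (Event nX))
      (hx : Generate G L (insert x D) x τ) (hl : GenerateLoop G L D l τ') :
      GenerateLoop G L D (x :: l) (τ ++ τ')

end

/-- A run of the branch-and-bound algorithm on input `G`, `L` and `a` (which is `k - 1`):
`GENERATE({x}, x)` is executed for all neighbours `x` of the last `Y`-vertex with label `a`,
in any order, each exactly once. -/
def EnumRun {nX nY : ℕ} (G : SimpleGraph (Fin nX ⊕ Fin nY)) (L : Fin nX → ℕ∞) (a : ℕ)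
    (τ : List (Event nX)) : Prop :=
  ∃ l : List (Fin nX), l.Nodup ∧ (∀ x, x ∈ l ↔ Nbr G x (nY - 1) ∧ L x = a) ∧
    GenerateLoop G L ∅ l τ

/-- The set that is output by an event, if any. -/
def Event.output? {nX : ℕ} : Event nX → Option (Finset (Fin nX))
  | .output D => some D
  | _ => none

/-- The sequence of the sets that are output. -/
def outputs {nX : ℕ} (τ : List (Event nX)) : List (Finset (Fin nX)) :=
  τ.filterMap Event.output?

/-- There are at most `B` calls and returns between any two consecutive outputs, before the
first output, and after the last one. -/
def CallDelayAtMost {nX : ℕ} (B : ℕ) (τ : List (Event nX)) : Prop :=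
  ∀ u v w : List (Event nX), τ = u ++ v ++ w → outputs v = [] → v.length ≤ B

/-- No failed partial solutions: after each call `GENERATE(D, x)` and before any call returns,
a set that extends `D` is output. -/
def NoFailedPartialSolution {nX : ℕ} (τ : List (Event nX)) : Prop :=
  ∀ (u w : List (Event nX)) (D : Finset (Fin nX)) (x : Fin nX), τ = u ++ Event.call D x :: w →
    ∃ (v w' : List (Event nX)) (D' : Finset (Fin nX)),
      w = v ++ Event.output D' :: w' ∧ D ⊆ D' ∧ Event.ret ∉ v

/-! ### Programs for a random access machine, with time and space

A program has finitely many registers and finitely many arrays, all of them holding natural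
numbers. -/

/-- Expressions. A program contains finitely many expressions of fixed size, so that the
evaluation of an expression takes constant time. -/
inductive RExpr : Type
  | const (n : ℕ) : RExpr
  | reg (r : ℕ) : RExpr
  | read (A : ℕ) (i : RExpr) : RExpr
  | plus (e f : RExpr) : RExpr
  | minus (e f : RExpr) : RExpr

/-- Register contents and array contents. -/
structure Store : Type where
  reg : ℕ → ℕ
  mem : ℕ → ℕ → ℕ

/-- The value of an expression; subtraction is truncated. -/
def RExpr.eval (s : Store) : RExpr → ℕ
  | .const n => n
  | .reg r => s.reg r
  | .read A i => s.mem A (i.eval s)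
  | .plus e f => e.eval s + f.eval s
  | .minus e f => e.eval s - f.eval s

/-- Programs. `ifLt e f c d` is "if `e < f` then `c` else `d`", `whileLt e f c` is
"while `e < f` do `c`", and `print A e` outputs the first `e` entries of array `A`. -/
inductive Prog : Type
  | skip : Prog
  | assign (r : ℕ) (e : RExpr) : Prog
  | write (A : ℕ) (i e : RExpr) : Prog
  | seq (c d : Prog) : Prog
  | ifLt (e f : RExpr) (c d : Prog) : Prog
  | whileLt (e f : RExpr) (c : Prog) : Prog
  | print (A : ℕ) (e : RExpr) : Prog

/-- `Exec S W c s t s'`: program `c`, started in store `s`, terminates in store `s'` with trace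
`t`, writes only to array cells with index below `S`, and stores only numbers that are at most
`W`. In the trace, `none` stands for one unit of time and `some l` for the output of the list
`l`. Each assignment, write and test takes one unit, printing `n` entries takes `n` units. -/
inductive Exec (S W : ℕ) : Prog → Store → List (Option (List ℕ)) → Store → Prop
  | skip (s : Store) : Exec S W .skip s [] s
  | assign (r : ℕ) (e : RExpr) (s : Store) (hW : e.eval s ≤ W) :
      Exec S W (.assign r e) s [none] ⟨Function.update s.reg r (e.eval s), s.mem⟩
  | write (A : ℕ) (i e : RExpr) (s : Store) (hS : i.eval s < S) (hW : e.eval s ≤ W) :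
      Exec S W (.write A i e) s [none]
        ⟨s.reg, Function.update s.mem A (Function.update (s.mem A) (i.eval s) (e.eval s))⟩
  | seq (c d : Prog) (s s' s'' : Store) (t t' : List (Option (List ℕ)))
      (hc : Exec S W c s t s') (hd : Exec S W d s' t' s'') :
      Exec S W (.seq c d) s (t ++ t') s''
  | ifTrue (e f : RExpr) (c d : Prog) (s s' : Store) (t : List (Option (List ℕ)))
      (h : e.eval s < f.eval s) (hc : Exec S W c s t s') :
      Exec S W (.ifLt e f c d) s (none :: t) s'
  | ifFalse (e f : RExpr) (c d : Prog) (s s' : Store) (t : List (Option (List ℕ)))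
      (h : ¬ e.eval s < f.eval s) (hd : Exec S W d s t s') :
      Exec S W (.ifLt e f c d) s (none :: t) s'
  | whileTrue (e f : RExpr) (c : Prog) (s s' s'' : Store) (t t' : List (Option (List ℕ)))
      (h : e.eval s < f.eval s) (hc : Exec S W c s t s')
      (hw : Exec S W (.whileLt e f c) s' t' s'') :
      Exec S W (.whileLt e f c) s (none :: (t ++ t')) s''
  | whileFalse (e f : RExpr) (c : Prog) (s : Store) (h : ¬ e.eval s < f.eval s) :
      Exec S W (.whileLt e f c) s [none] s
  | print (A : ℕ) (e : RExpr) (s : Store) :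
      Exec S W (.print A e) s
        (List.replicate (e.eval s) none ++ [some ((List.range (e.eval s)).map (s.mem A))]) s

/-- The input: `nX`, `nY` and `a` (which is `k - 1`) in the registers 0, 1, 2; the neighbourhood
array (`left` and `right`) in the arrays 0 and 1, and the labels, with `nX` in place of `∞`, in
array 2; zeros elsewhere. -/
noncomputable def inputStore {nX nY : ℕ} (G : SimpleGraph (Fin nX ⊕ Fin nY)) (L : Fin nX → ℕ∞)
    (a : ℕ) : Store where
  reg r := if r = 0 then nX else if r = 1 then nY else if r = 2 then a else 0
  mem A i :=
    open Classical in
    if h : i < nX then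
      if A = 0 then left G ⟨i, h⟩
      else if A = 1 then right G ⟨i, h⟩
      else if A = 2 then (if L ⟨i, h⟩ = ⊤ then nX else (L ⟨i, h⟩).toNat)
      else 0
    else 0

/-- The trace `t` prints the sets of the list `Ds`, in this order. -/
def Prints {nX : ℕ} (t : List (Option (List ℕ))) (Ds : List (Finset (Fin nX))) : Prop :=
  t.reduceOption.map List.toFinset = Ds.map (Finset.map Fin.valEmbedding)

/-- At most `B` units of time pass before the first output. -/
def FirstOutputWithin (B : ℕ) (t : List (Option (List ℕ))) : Prop :=
  ∀ v w : List (Option (List ℕ)), t = v ++ w → v.reduceOption = [] → v.length ≤ B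

/-- At most `B` units of time pass between any two consecutive outputs, and between the last
output and the end. -/
def DelayAtMost (B : ℕ) (t : List (Option (List ℕ))) : Prop :=
  ∀ u v w : List (Option (List ℕ)), t = u ++ v ++ w → u.reduceOption ≠ [] →
    v.reduceOption = [] → v.length ≤ B

end RedDom

namespace RedDom

-- Neighbourhoods as intervals, and the labelling algorithm

section Label

variable {nX nY : ℕ} {G : SimpleGraph (Fin nX ⊕ Fin nY)}

-- Every `X`-vertex is an interval of `Y`. `Arc` joins two intervals that can be consecutive in an
-- irredundant cover: both ends increase and no `Y`-vertex is missed in between. The labels are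
-- distances along arcs from the intervals containing the first `Y`-vertex. Only three closure
-- properties of them are needed (`IsLabelling`): a vertex with label `n` ends an arc path with
-- labels `0, …, n`, whose `n + 1` vertices dominate everything up to its right end.
--
-- Conversely, no interval of a minimum red dominating set contains another one, so the set, sorted
-- by left ends, is an arc path. Its labels cannot exceed the positions, by relaxation, and cannot
-- be smaller, since a smaller label would give a shorter path that could replace an initial part of
-- the set (`IsMCRD.le_label`). Hence the MCRD sets are exactly the label paths with `k` vertices
-- ending at a neighbour of the last `Y`-vertex (`isMCRD_iff_exists_pathSet`), and the recursion
-- traces these paths backwards. No branch fails, because a positive finite label always has a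
-- predecessor with the preceding label. No set is repeated, because the labels on a path are
-- distinct, so that the set determines the path. Two consecutive outputs are separated only by at
-- most `k` returns followed by at most `k` calls.
--
-- For the machine, the next candidate must be found in constant time and with space linear in `nX`.
-- The vertices met by the search are `Tight`, and for these `Tight.arc_iff` reduces being a
-- candidate, within the preceding label class, to one inequality on right ends. So in a class
-- sorted by decreasing right end the candidates form an initial segment, and a linked list with one
-- comparison per step suffices. Bucketing by right ends would cost space `nY`. Instead, the bucket
-- of `x` is the first index whose left end is too far to the right to follow `x`; this is all that
-- the inequality can detect, and there are only `nX + 2` buckets. It is found by walking over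
-- distinct left ends, which costs about the degree of `x`, so the preprocessing is linear in `nX`
-- plus the number of edges. The search itself is a loop whose only stack is the partial solution.

theorem Nbr.lt {x : Fin nX} {j : ℕ} (h : Nbr G x j) : j < nY := h.1

namespace IsLexConvex

/-- Both sides are nonempty, so the connected graph is nontrivial and has no isolated vertex. This
keeps `left` and `right` from being the junk values of `sInf` and `sSup` on the empty set. -/
theorem exists_nbr (hG : IsLexConvex G) (x : Fin nX) : ∃ j, Nbr G x j := by
  have : Nontrivial (Fin nX ⊕ Fin nY) :=
    ⟨Sum.inl x, Sum.inr ⟨0, hG.nonemptyY⟩, by simp⟩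
  obtain ⟨v, hv⟩ := hG.connected.preconnected.exists_adj_of_nontrivial (Sum.inl x)
  rcases hG.bipartite.mem_of_adj hv with ⟨-, y, rfl⟩ | ⟨⟨y, hy⟩, -⟩
  · exact ⟨y, y.2, hv⟩
  · simp at hy

theorem exists_nbr_of_lt (hG : IsLexConvex G) {j : ℕ} (hj : j < nY) : ∃ x, Nbr G x j := by
  have : Nontrivial (Fin nX ⊕ Fin nY) :=
    ⟨Sum.inl ⟨0, hG.nonemptyX⟩, Sum.inr ⟨j, hj⟩, by simp⟩
  obtain ⟨v, hv⟩ := hG.connected.preconnected.exists_adj_of_nontrivial (Sum.inr ⟨j, hj⟩)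
  rcases hG.bipartite.mem_of_adj hv with ⟨⟨y, hy⟩, -⟩ | ⟨-, x, rfl⟩
  · simp at hy
  · exact ⟨x, hj, hv.symm⟩

theorem nbr_left (hG : IsLexConvex G) (x : Fin nX) : Nbr G x (left G x) :=
  Nat.sInf_mem (s := {j | Nbr G x j}) (hG.exists_nbr x)

theorem nbr_right (hG : IsLexConvex G) (x : Fin nX) : Nbr G x (right G x) :=
  Nat.sSup_mem (s := {j | Nbr G x j}) (hG.exists_nbr x) ⟨nY, fun _ h => h.lt.le⟩

theorem nbr_iff (hG : IsLexConvex G) {x : Fin nX} {j : ℕ} :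
    Nbr G x j ↔ left G x ≤ j ∧ j ≤ right G x := by
  constructor
  · intro h
    exact ⟨Nat.sInf_le h, le_csSup (s := {j | Nbr G x j}) ⟨nY, fun _ h => h.lt.le⟩ h⟩
  · rintro ⟨h1, h2⟩
    obtain ⟨hl, hl'⟩ := hG.nbr_left x
    obtain ⟨hr, hr'⟩ := hG.nbr_right x
    have hj : j < nY := h2.trans_lt hr
    exact ⟨hj, (hG.convex x).out hl' hr' ⟨h1, h2⟩⟩

theorem right_lt (hG : IsLexConvex G) (x : Fin nX) : right G x < nY := (hG.nbr_right x).lt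

theorem left_le_right (hG : IsLexConvex G) (x : Fin nX) : left G x ≤ right G x :=
  (hG.nbr_iff.1 (hG.nbr_left x)).2

theorem nbr_zero_iff (hG : IsLexConvex G) {x : Fin nX} : Nbr G x 0 ↔ left G x = 0 := by
  rw [hG.nbr_iff]; omega

theorem nbr_last_iff (hG : IsLexConvex G) {x : Fin nX} :
    Nbr G x (nY - 1) ↔ right G x + 1 = nY := by
  have := hG.right_lt x
  have := hG.left_le_right x
  rw [hG.nbr_iff]; omega

theorem lt_of_left_lt (hG : IsLexConvex G) {x x' : Fin nX} (h : left G x < left G x') :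
    x < x' := by
  by_contra! hx
  rcases hx.eq_or_lt with rfl | hx
  · exact lt_irrefl _ h
  · have := hG.lex _ _ hx
    omega

theorem left_mono (hG : IsLexConvex G) {x x' : Fin nX} (h : x ≤ x') : left G x ≤ left G x' := by
  by_contra! hx
  exact absurd (hG.lt_of_left_lt hx) h.not_gt

end IsLexConvex

/-- `S` dominates the `Y`-vertices with index at most `m`. -/
def Covers (G : SimpleGraph (Fin nX ⊕ Fin nY)) (S : Finset (Fin nX)) (m : ℕ) : Prop :=
  ∀ j ≤ m, ∃ x ∈ S, left G x ≤ j ∧ j ≤ right G x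

theorem IsLexConvex.isRedDominating_iff (hG : IsLexConvex G) {D : Finset (Fin nX)} :
    IsRedDominating G D ↔ Covers G D (nY - 1) := by
  have := hG.nonemptyY
  constructor
  · intro h j hj
    obtain ⟨x, hx, hadj⟩ := h ⟨j, by omega⟩
    exact ⟨x, hx, hG.nbr_iff.1 ⟨_, hadj⟩⟩
  · intro h y
    obtain ⟨x, hx, hj⟩ := h y (by omega)
    exact ⟨x, hx, (hG.nbr_iff.2 hj).2⟩

/-- All of `X` is red dominating, since no `Y`-vertex is isolated; so the infimum in `mcrdCard` is
attained. -/
theorem IsLexConvex.exists_isMCRD (hG : IsLexConvex G) :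
    ∃ D, IsMCRD G D ∧ D.card = mcrdCard G := by
  have hne : {c | ∃ D : Finset (Fin nX), IsRedDominating G D ∧ D.card = c}.Nonempty := by
    refine ⟨_, Finset.univ, fun y => ?_, rfl⟩
    obtain ⟨x, hx⟩ := hG.exists_nbr_of_lt y.2
    exact ⟨x, Finset.mem_univ _, hx.2⟩
  obtain ⟨D, hD, hc⟩ := Nat.sInf_mem hne
  exact ⟨D, ⟨hD, fun D' hD' => hc.trans_le (Nat.sInf_le ⟨D', hD', rfl⟩)⟩, hc⟩

theorem mcrdCard_le {D : Finset (Fin nX)} (hD : IsRedDominating G D) : mcrdCard G ≤ D.card :=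
  Nat.sInf_le ⟨D, hD, rfl⟩

theorem IsLexConvex.isMCRD_iff (hG : IsLexConvex G) {D : Finset (Fin nX)} :
    IsMCRD G D ↔ IsRedDominating G D ∧ D.card ≤ mcrdCard G := by
  constructor
  · intro h
    obtain ⟨D', hD', hc⟩ := hG.exists_isMCRD
    exact ⟨h.1, hc ▸ h.2 D' hD'.1⟩
  · exact fun h => ⟨h.1, fun D' hD' => h.2.trans (mcrdCard_le hD')⟩

theorem IsLexConvex.mcrdCard_pos (hG : IsLexConvex G) : 0 < mcrdCard G := by
  obtain ⟨D, hD, hc⟩ := hG.exists_isMCRD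
  obtain ⟨x, hx, -⟩ := hD.1 ⟨0, hG.nonemptyY⟩
  exact hc ▸ Finset.card_pos.2 ⟨x, hx⟩

/-- `x'` may follow `x` in a minimum red dominating set. -/
def Arc (G : SimpleGraph (Fin nX ⊕ Fin nY)) (x x' : Fin nX) : Prop :=
  left G x < left G x' ∧ left G x' ≤ right G x + 1 ∧ right G x + 1 ≤ right G x'

theorem IsLexConvex.candidate_iff (hG : IsLexConvex G) {L : Fin nX → ℕ∞} {x x' : Fin nX} :
    Candidate G L x x' ↔ Arc G x' x ∧ L x' + 1 = L x := by
  constructor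
  · rintro ⟨-, h1, h2, h3, h4⟩
    exact ⟨⟨h1, h2, h3⟩, h4⟩
  · rintro ⟨⟨h1, h2, h3⟩, h4⟩
    exact ⟨hG.lt_of_left_lt h1, h1, h2, h3, h4⟩

/-- The labels are the distances from the neighbours of the first `Y`-vertex along arcs. -/
structure IsLabelling (G : SimpleGraph (Fin nX ⊕ Fin nY)) (L : Fin nX → ℕ∞) : Prop where
  zero : ∀ x, Nbr G x 0 → L x = 0
  relax : ∀ x x', Arc G x x' → L x' ≤ L x + 1
  pred : ∀ x, L x ≠ ⊤ → Nbr G x 0 ∨ ∃ p, Arc G p x ∧ L p + 1 ≤ L x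

/-- The invariant of the labelling algorithm. -/
structure LabelInv (G : SimpleGraph (Fin nX ⊕ Fin nY)) (Q : List (Fin nX)) (L : Fin nX → ℕ∞) :
    Prop where
  zero : ∀ x, Nbr G x 0 → L x = 0
  relax : ∀ x, x ∉ Q → ∀ x', Arc G x x' → L x' ≤ L x + 1
  pred : ∀ x, L x ≠ ⊤ → Nbr G x 0 ∨ ∃ p, Arc G p x ∧ L p + 1 ≤ L x
  fin : ∀ x ∈ Q, L x ≠ ⊤

-- Correctness and termination of the labelling algorithm

/-- As `x` is not among its own targets, its label stays fixed during the inner loop, so the whole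
pass acts like one simultaneous update. The last clause, that the queue gains nothing when no label
drops, is what termination needs. -/
theorem foldl_labelBody_spec (x : Fin nX) (l : List (Fin nX)) (hx : x ∉ l)
    (Q : List (Fin nX)) (L : Fin nX → ℕ∞) (hL : ∀ y ∈ l, L x + 1 ≤ L y) :
    (l.foldl (labelBody x) (Q, L)).2 = (fun y => if y ∈ l then L x + 1 else L y) ∧
      (∀ y, y ∈ (l.foldl (labelBody x) (Q, L)).1 ↔ y ∈ Q ∨ (y ∈ l ∧ L x + 1 < L y)) ∧
      ((∀ y ∈ l, L x + 1 = L y) → (l.foldl (labelBody x) (Q, L)).1 = Q) := by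
  induction l generalizing Q L with
  | nil => simp
  | cons z l ih =>
    simp only [List.mem_cons, not_or] at hx
    have hz := hL z (by simp)
    have hxx : (Function.update L z (L x + 1)) x = L x := Function.update_of_ne hx.1 _ _
    have key := ih hx.2 (labelBody x (Q, L) z).1 (labelBody x (Q, L) z).2 (by
      intro y hy
      simp only [labelBody, hxx]
      by_cases hyz : y = z
      · subst hyz; simp
      · rw [Function.update_of_ne hyz]; exact hL y (by simp [hy]))
    simp only [List.foldl_cons]
    have e2 : (labelBody x (Q, L) z).2 = Function.update L z (L x + 1) := rfl
    have e1 : (labelBody x (Q, L) z).1 = if L x + 1 < L z then Q ++ [z] else Q := rfl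
    have e : labelBody x (Q, L) z = ((labelBody x (Q, L) z).1, (labelBody x (Q, L) z).2) := rfl
    rw [e]
    refine ⟨?_, ?_, ?_⟩
    · rw [key.1, e2, hxx]
      funext y
      by_cases hyz : y = z
      · subst hyz; simp
      · simp [hyz]
    · intro y
      rw [key.2.1, e1, e2, hxx]
      by_cases hyz : y = z
      · subst hyz
        by_cases hlt : L x + 1 < L y <;> simp [hlt]
      · by_cases hlt : L x + 1 < L z <;> simp [hlt, hyz]
    · intro h
      rw [key.2.2, e1, if_neg]
      · exact (h z (by simp)).not_lt
      · intro y hy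
        rw [e2, hxx]
        by_cases hyz : y = z
        · subst hyz; simp
        · rw [Function.update_of_ne hyz]; exact h y (by simp [hy])

theorem IsLexConvex.mem_labelTargets (hG : IsLexConvex G) {L : Fin nX → ℕ∞} {x y : Fin nX} :
    y ∈ labelTargets G L x ↔ Arc G x y ∧ L x + 1 ≤ L y := by
  simp only [labelTargets, List.mem_filter, List.mem_finRange, true_and, decide_eq_true_eq, Arc]
  constructor
  · tauto
  · rintro ⟨⟨h1, h2, h3⟩, h4⟩
    exact ⟨hG.lt_of_left_lt h1, h1, h2, h3, h4⟩

theorem IsLexConvex.labelStep_spec (hG : IsLexConvex G) (L : Fin nX → ℕ∞) (x : Fin nX)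
    (Q : List (Fin nX)) :
    ((labelTargets G L x).foldl (labelBody x) (Q, L)).2 =
        (fun y => if y ∈ labelTargets G L x then L x + 1 else L y) ∧
      (∀ y, y ∈ ((labelTargets G L x).foldl (labelBody x) (Q, L)).1 ↔
        y ∈ Q ∨ (y ∈ labelTargets G L x ∧ L x + 1 < L y)) ∧
      ((∀ y ∈ labelTargets G L x, L x + 1 = L y) →
        ((labelTargets G L x).foldl (labelBody x) (Q, L)).1 = Q) :=
  foldl_labelBody_spec x _ (fun h => lt_irrefl _ (hG.mem_labelTargets.1 h).1.1) Q L
    fun _ hy => (hG.mem_labelTargets.1 hy).2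

/-- A label-correcting argument: a vertex whose label drops is enqueued, so arcs out of vertices
outside the queue stay relaxed. The first-in-first-out order plays no role. -/
theorem LabelInv.step (hG : IsLexConvex G) {x : Fin nX} {Q : List (Fin nX)} {L : Fin nX → ℕ∞}
    (h : LabelInv G (x :: Q) L) :
    LabelInv G ((labelTargets G L x).foldl (labelBody x) (Q, L)).1
        ((labelTargets G L x).foldl (labelBody x) (Q, L)).2 := by
  obtain ⟨h2, h1, -⟩ := hG.labelStep_spec L x Q
  rw [h2]
  have hfin : L x ≠ ⊤ := h.fin x (by simp)
  have hfin' : L x + 1 ≠ ⊤ := by simpa using hfin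
  have hxt : x ∉ labelTargets G L x := fun h => lt_irrefl _ (hG.mem_labelTargets.1 h).1.1
  have hle : ∀ y, (if y ∈ labelTargets G L x then L x + 1 else L y) ≤ L y := by
    intro y
    split_ifs with hy
    · exact (hG.mem_labelTargets.1 hy).2
    · exact le_rfl
  refine ⟨?_, ?_, ?_, ?_⟩
  · intro y hy
    have := hle y
    rw [h.zero y hy] at this
    simpa [h.zero y hy] using this
  · intro y hy z hyz
    rw [h1] at hy
    push Not at hy
    by_cases hyx : y = x
    · subst hyx
      rw [if_neg hxt]
      split_ifs with hz
      · exact le_rfl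
      · by_contra! hlt
        exact hz (hG.mem_labelTargets.2 ⟨hyz, hlt.le⟩)
    · have hyQ : y ∉ x :: Q := by simp [hyx, hy.1]
      have h3 := h.relax y hyQ z hyz
      -- A target that was not enqueued already had the label `L x + 1`, so its label does not
      -- change.
      have h4 : (if y ∈ labelTargets G L x then L x + 1 else L y) = L y := by
        split_ifs with hyt
        · exact le_antisymm (hG.mem_labelTargets.1 hyt).2 (hy.2 hyt)
        · rfl
      rw [h4]
      exact (hle z).trans h3
  · intro y hy
    by_cases hyt : y ∈ labelTargets G L x
    · refine Or.inr ⟨x, (hG.mem_labelTargets.1 hyt).1, ?_⟩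
      simp [hyt, hxt]
    · simp only [hyt, if_false] at hy ⊢
      rcases h.pred y hy with h5 | ⟨p, hp, hpy⟩
      · exact Or.inl h5
      · exact Or.inr ⟨p, hp, (add_le_add_left (hle p) 1).trans hpy⟩
  · intro y hy
    rcases (h1 y).1 hy with h5 | h5
    · split_ifs
      · exact hfin'
      · exact h.fin y (by simp [h5])
    · simpa [h5.1] using hfin

theorem LabelInv.isLabelling {L : Fin nX → ℕ∞} (h : LabelInv G [] L) : IsLabelling G L :=
  ⟨h.zero, fun x x' hx => h.relax x (by simp) x' hx, h.pred⟩

theorem LabelLoop.isLabelling (hG : IsLexConvex G) {Q : List (Fin nX)} {L L' : Fin nX → ℕ∞}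
    (h : LabelLoop G Q L L') (hI : LabelInv G Q L) : IsLabelling G L' := by
  induction h with
  | done L => exact hI.isLabelling
  | step x Q L L' _ ih => exact ih (hI.step hG)

theorem labelInv_init : open Classical in
    LabelInv G ((List.finRange nX).filter fun x => decide (Nbr G x 0))
      (fun x => if Nbr G x 0 then 0 else ⊤) := by
  refine ⟨?_, ?_, ?_, ?_⟩
  · intro x hx; simp [hx]
  · intro x hx x' _
    have : ¬ Nbr G x 0 := by simpa using hx
    simp [this]
  · intro x hx
    left
    by_contra h
    simp [h] at hx
  · intro x hx
    have : Nbr G x 0 := by simpa using hx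
    simp [this]

theorem LabelOutput.isLabelling (hG : IsLexConvex G) {L : Fin nX → ℕ∞} (h : LabelOutput G L) :
    IsLabelling G L :=
  LabelLoop.isLabelling hG h labelInv_init

/-- Lexicographic termination: either the label array drops in the well-founded pointwise order, or
it is unchanged and the queue loses its head. -/
theorem exists_labelLoop (hG : IsLexConvex G) (L : Fin nX → ℕ∞) (Q : List (Fin nX)) :
    ∃ L', LabelLoop G Q L L' := by
  induction L using WellFoundedLT.induction generalizing Q with
  | ind L ihL =>
    induction Q with
    | nil => exact ⟨L, .done L⟩
    | cons x Q ihQ =>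
      obtain ⟨h2, -, h1⟩ := hG.labelStep_spec L x Q
      by_cases hall : ∀ y ∈ labelTargets G L x, L x + 1 = L y
      · obtain ⟨L', hL'⟩ := ihQ
        refine ⟨L', .step x Q L L' ?_⟩
        rw [h1 hall, h2]
        convert hL' using 1
        funext y
        split_ifs with hy
        · exact hall y hy
        · rfl
      · push Not at hall
        obtain ⟨y, hy, hne⟩ := hall
        obtain ⟨L', hL'⟩ := ihL ((labelTargets G L x).foldl (labelBody x) (Q, L)).2 (by
          rw [h2, Pi.lt_def]
          refine ⟨fun z => ?_, y, ?_⟩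
          · dsimp only
            split_ifs with hz
            · exact (hG.mem_labelTargets.1 hz).2
            · exact le_rfl
          · simpa [hy] using lt_of_le_of_ne (hG.mem_labelTargets.1 hy).2 hne)
          ((labelTargets G L x).foldl (labelBody x) (Q, L)).1
        exact ⟨L', .step x Q L L' hL'⟩

theorem exists_labelOutput (hG : IsLexConvex G) : ∃ L, LabelOutput G L :=
  exists_labelLoop hG _ _

end Label

-- Minimum red dominating sets as label paths

section Tight

variable {nX nY : ℕ} {G : SimpleGraph (Fin nX ⊕ Fin nY)} {L : Fin nX → ℕ∞}

theorem Covers.mono {S T : Finset (Fin nX)} {m n : ℕ} (h : Covers G S m) (hST : S ⊆ T)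
    (hn : n ≤ m) : Covers G T n := by
  intro j hj
  obtain ⟨x, hx, hxj⟩ := h j (hj.trans hn)
  exact ⟨x, hST hx, hxj⟩

theorem Covers.insert {S : Finset (Fin nX)} {m : ℕ} {x : Fin nX} (h : Covers G S m)
    (hx : left G x ≤ m + 1) : Covers G (insert x S) (right G x) := by
  intro j hj
  by_cases hjm : j ≤ m
  · obtain ⟨y, hy, hyj⟩ := h j hjm
    exact ⟨y, Finset.mem_insert_of_mem hy, hyj⟩
  · exact ⟨x, Finset.mem_insert_self _ _, by omega, hj⟩

theorem covers_singleton {x : Fin nX} (hx : left G x = 0) : Covers G {x} (right G x) :=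
  fun j hj => ⟨x, by simp, by omega, hj⟩

namespace IsLabelling

theorem left_eq_zero (hL : IsLabelling G L) (hG : IsLexConvex G) {x : Fin nX} (hx : L x = 0) :
    left G x = 0 := by
  rcases hL.pred x (by simp [hx]) with h | ⟨p, -, hp⟩
  · exact hG.nbr_zero_iff.1 h
  · simp [hx] at hp

/-- The bounds from `pred` and `relax` on the label of the predecessor meet. This is why no partial
solution fails. -/
theorem exists_arc (hL : IsLabelling G L) {x : Fin nX} {n : ℕ} (hx : L x = (n + 1 : ℕ)) :
    ∃ p, Arc G p x ∧ L p = n := by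
  rcases hL.pred x (by simp [hx]) with h | ⟨p, hp, hpx⟩
  · have := hL.zero x h
    rw [this] at hx
    norm_cast at hx
  · refine ⟨p, hp, ?_⟩
    have h1 := le_antisymm hpx (hL.relax p x hp)
    rw [hx, Nat.cast_add, Nat.cast_one] at h1
    exact ENat.add_left_injective_of_ne_top (by simp) h1

end IsLabelling

/-- `S` is the set of vertices of an arc path along which the labels are `0, …, n` and which
ends in `x`. -/
def PathSet (G : SimpleGraph (Fin nX ⊕ Fin nY)) (L : Fin nX → ℕ∞) :
    ℕ → Fin nX → Finset (Fin nX) → Prop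
  | 0, x, S => L x = 0 ∧ S = {x}
  | n + 1, x, S => L x = (n + 1 : ℕ) ∧
      ∃ x', Arc G x' x ∧ ∃ S', PathSet G L n x' S' ∧ S = insert x S'

namespace PathSet

variable {n : ℕ} {x : Fin nX} {S : Finset (Fin nX)}

theorem label_eq (h : PathSet G L n x S) : L x = n := by
  cases n with
  | zero => simpa using h.1
  | succ n => exact h.1

theorem label_le (h : PathSet G L n x S) {y : Fin nX} (hy : y ∈ S) : L y ≤ n := by
  induction n generalizing x S with
  | zero =>
    obtain ⟨h1, rfl⟩ := h
    simp only [Finset.mem_singleton] at hy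
    simp [hy, h1]
  | succ n ih =>
    obtain ⟨h1, x', -, S', hS', rfl⟩ := h
    rcases Finset.mem_insert.1 hy with rfl | hy
    · exact h1.le
    · exact (ih hS' hy).trans (by norm_cast; omega)

theorem card_eq (h : PathSet G L n x S) : S.card = n + 1 := by
  induction n generalizing x S with
  | zero =>
    obtain ⟨h1, rfl⟩ := h
    simp
  | succ n ih =>
    obtain ⟨h1, x', -, S', hS', rfl⟩ := h
    rw [Finset.card_insert_of_notMem, ih hS']
    intro hx
    have := hS'.label_le hx
    rw [h1] at this
    norm_cast at this
    omega

theorem covers (hG : IsLexConvex G) (hL : IsLabelling G L) (h : PathSet G L n x S) :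
    Covers G S (right G x) := by
  induction n generalizing x S with
  | zero =>
    obtain ⟨h1, rfl⟩ := h
    exact covers_singleton (hL.left_eq_zero hG h1)
  | succ n ih =>
    obtain ⟨h1, x', hx', S', hS', rfl⟩ := h
    exact (ih hS').insert hx'.2.1

end PathSet

theorem IsLabelling.exists_pathSet (hL : IsLabelling G L) {n : ℕ} {x : Fin nX} (hx : L x = n) :
    ∃ S, PathSet G L n x S := by
  induction n generalizing x with
  | zero => exact ⟨{x}, by simpa using hx, rfl⟩
  | succ n ih =>
    obtain ⟨p, hp, hpn⟩ := hL.exists_arc hx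
    obtain ⟨S, hS⟩ := ih hpn
    exact ⟨_, hx, p, hp, S, hS, rfl⟩

/-- A label path has `n + 1` distinct vertices. So `nX` can encode `∞`, and arrays indexed by labels
have linear size. -/
theorem IsLabelling.label_lt (hL : IsLabelling G L) {n : ℕ} {x : Fin nX} (hx : L x = n) :
    n < nX := by
  obtain ⟨S, hS⟩ := hL.exists_pathSet hx
  have := S.card_le_univ
  rw [hS.card_eq, Fintype.card_fin] at this
  omega

/-- `x` has label `n`, and `n + 1` vertices are needed to dominate the `Y`-vertices up to the
last neighbour of `x`. -/
def Tight (G : SimpleGraph (Fin nX ⊕ Fin nY)) (L : Fin nX → ℕ∞) (n : ℕ) (x : Fin nX) : Prop :=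
  L x = n ∧ ∀ S : Finset (Fin nX), Covers G S (right G x) → n + 1 ≤ S.card

/-- A cheaper cover up to the end of `x'` would, with `x` added, be a cheaper cover up to the end of
`x`. Thus tightness passes to every vertex that the backward search reaches. -/
theorem Tight.of_arc {n : ℕ} {x x' : Fin nX} (h : Tight G L (n + 1) x) (hx' : Arc G x' x)
    (hn : L x' = n) : Tight G L n x' := by
  refine ⟨hn, fun S hS => ?_⟩
  have h1 := h.2 _ (hS.insert hx'.2.1)
  have h2 := Finset.card_insert_le x S
  omega

/-- Among the vertices with the preceding label, the candidates of a tight vertex are recognized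
by their last neighbour. -/
theorem Tight.arc_iff (hG : IsLexConvex G) (hL : IsLabelling G L) {n : ℕ} {x x' : Fin nX}
    (h : Tight G L (n + 1) x) (hn : L x' = n) : Arc G x' x ↔ left G x < right G x' + 2 := by
  refine ⟨fun hx' => by have := hx'.2.1; omega, fun hlt => ⟨?_, by omega, ?_⟩⟩
  -- If `x` began no later than `x'`, it could replace `x'` after a predecessor of `x'` and save one
  -- vertex; for `n = 0` it would itself contain the first `Y`-vertex and have label `0`.
  · by_contra! hle
    cases n with
    | zero =>
      have h0 := hL.left_eq_zero hG (x := x') (by simpa using hn)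
      have h1 := hL.zero x (hG.nbr_zero_iff.2 (by omega))
      have h2 := h.1
      rw [h1] at h2
      norm_cast at h2
    | succ m =>
      obtain ⟨p, hp, hpm⟩ := hL.exists_arc hn
      obtain ⟨S, hS⟩ := hL.exists_pathSet hpm
      have h1 := h.2 _ ((hS.covers hG hL).insert (x := x) (hle.trans hp.2.1))
      have h2 := Finset.card_insert_le x S
      rw [hS.card_eq] at h2
      omega
  -- If `x'` reached as far as `x`, a path ending in `x'` would dominate the same range with one
  -- vertex less.
  · by_contra! hle
    obtain ⟨S, hS⟩ := hL.exists_pathSet hn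
    have h1 := h.2 S ((hS.covers hG hL).mono subset_rfl (by omega))
    rw [hS.card_eq] at h1
    omega

theorem tight_of_last (hG : IsLexConvex G) {n : ℕ} {x : Fin nX}
    (hn : n + 1 = mcrdCard G) (hx : Nbr G x (nY - 1)) (hxn : L x = n) : Tight G L n x := by
  refine ⟨hxn, fun S hS => ?_⟩
  rw [hn]
  refine mcrdCard_le (hG.isRedDominating_iff.2 (hS.mono subset_rfl ?_))
  exact (hG.nbr_iff.1 hx).2

theorem mcrdCard_le_label (hG : IsLexConvex G) (hL : IsLabelling G L) {n : ℕ} {x : Fin nX}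
    (hx : Nbr G x (nY - 1)) (hxn : L x = n) : mcrdCard G ≤ n + 1 := by
  obtain ⟨S, hS⟩ := hL.exists_pathSet hxn
  rw [← hS.card_eq]
  exact mcrdCard_le (hG.isRedDominating_iff.2 ((hS.covers hG hL).mono subset_rfl
    (hG.nbr_iff.1 hx).2))

theorem PathSet.isMCRD (hG : IsLexConvex G) (hL : IsLabelling G L) {n : ℕ} {x : Fin nX}
    {S : Finset (Fin nX)} (hn : n + 1 = mcrdCard G) (hx : Nbr G x (nY - 1))
    (hS : PathSet G L n x S) : IsMCRD G S := by
  rw [hG.isMCRD_iff]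
  exact ⟨hG.isRedDominating_iff.2 ((hS.covers hG hL).mono subset_rfl (hG.nbr_iff.1 hx).2),
    by rw [hS.card_eq, hn]⟩

/-- Neighbourhoods in a minimum red dominating set are not nested. -/
theorem IsMCRD.right_lt_right (hG : IsLexConvex G) {D : Finset (Fin nX)} (hD : IsMCRD G D)
    {x z : Fin nX} (hx : x ∈ D) (hz : z ∈ D) (hne : z ≠ x) (hzx : left G z ≤ left G x) :
    right G z < right G x := by
  by_contra! hle
  -- Otherwise the interval of `x` lies inside that of `z`, and `x` can be dropped.
  have h1 : IsRedDominating G (D.erase x) := by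
    rw [hG.isRedDominating_iff]
    intro j hj
    obtain ⟨y, hy, hyj⟩ := hG.isRedDominating_iff.1 hD.1 j hj
    by_cases hyx : y = x
    · subst hyx
      exact ⟨z, by simp [hz, hne], by omega, by omega⟩
    · exact ⟨y, by simp [hy, hyx], hyj⟩
  have h2 := hD.2 _ h1
  rw [Finset.card_erase_of_mem hx] at h2
  have := Finset.card_pos.2 ⟨x, hx⟩
  omega

/-- Exchange: the members of `D` up to `x` reach no further than `x`, so a label path ending in `x`
can replace all of them. Minimality of `D` then bounds their number by the length of the path. -/
theorem IsMCRD.le_label (hG : IsLexConvex G) (hL : IsLabelling G L) {D : Finset (Fin nX)}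
    (hD : IsMCRD G D) {x : Fin nX} (hx : x ∈ D) {m : ℕ} (hxm : L x = m) :
    (D.filter fun z => left G z ≤ left G x).card ≤ m + 1 := by
  obtain ⟨S, hS⟩ := hL.exists_pathSet hxm
  have h1 : IsRedDominating G (S ∪ D.filter fun z => ¬ left G z ≤ left G x) := by
    rw [hG.isRedDominating_iff]
    intro j hj
    by_cases hjx : j ≤ right G x
    · obtain ⟨y, hy, hyj⟩ := hS.covers hG hL j hjx
      exact ⟨y, by simp [hy], hyj⟩
    · obtain ⟨y, hy, hyj⟩ := hG.isRedDominating_iff.1 hD.1 j hj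
      refine ⟨y, ?_, hyj⟩
      simp only [Finset.mem_union, Finset.mem_filter]
      refine Or.inr ⟨hy, fun hle => ?_⟩
      by_cases hyx : y = x
      · subst hyx; omega
      · have := hD.right_lt_right hG hx hy hyx hle
        omega
  have h2 := (hD.2 _ h1).trans (Finset.card_union_le _ _)
  rw [hS.card_eq] at h2
  have h3 := Finset.card_filter_add_card_filter_not (s := D) (fun z => left G z ≤ left G x)
  omega

/-- Induction on the position of `x` in `D` sorted by left end; the predecessor on the path is the
member `p` with the next smaller left end. -/
theorem IsMCRD.pathSet_filter (hG : IsLexConvex G) (hL : IsLabelling G L) {D : Finset (Fin nX)}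
    (hD : IsMCRD G D) {m : ℕ} {x : Fin nX} (hx : x ∈ D)
    (hm : (D.filter fun z => left G z ≤ left G x).card = m + 1) :
    PathSet G L m x (D.filter fun z => left G z ≤ left G x) := by
  have huniq : ∀ z ∈ D, left G z = left G x → z = x := by
    intro z hz hzx
    by_contra hne
    have h1 := hD.right_lt_right hG hx hz hne hzx.le
    have h2 := hD.right_lt_right hG hz hx (Ne.symm hne) hzx.ge
    omega
  induction m generalizing x with
  | zero =>
    have hS : (D.filter fun z => left G z ≤ left G x) = {x} := by
      obtain ⟨y, hy⟩ := Finset.card_eq_one.1 hm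
      have : x ∈ D.filter fun z => left G z ≤ left G x := by simp [hx]
      rw [hy] at this ⊢
      rw [Finset.mem_singleton.1 this]
    refine ⟨hL.zero x (hG.nbr_zero_iff.2 ?_), hS⟩
    obtain ⟨y, hy, hyj⟩ := hG.isRedDominating_iff.1 hD.1 0 (Nat.zero_le _)
    have : y ∈ D.filter fun z => left G z ≤ left G x := by simp [hy]; omega
    rw [hS, Finset.mem_singleton] at this
    subst this
    omega
  | succ m ih =>
    have hne : (D.filter fun z => left G z < left G x).Nonempty := by
      by_contra hemp
      rw [Finset.not_nonempty_iff_eq_empty, Finset.filter_eq_empty_iff] at hemp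
      have : (D.filter fun z => left G z ≤ left G x) ⊆ {x} := by
        intro z hz
        simp only [Finset.mem_filter] at hz
        have := hemp hz.1
        exact Finset.mem_singleton.2 (huniq z hz.1 (by omega))
      have := Finset.card_le_card this
      simp at this
      omega
    obtain ⟨p, hp, hmax⟩ := Finset.exists_max_image _ (fun z => left G z) hne
    simp only [Finset.mem_filter] at hp hmax
    have hS : (D.filter fun z => left G z ≤ left G x) =
        insert x (D.filter fun z => left G z ≤ left G p) := by
      ext z
      simp only [Finset.mem_filter, Finset.mem_insert]
      constructor
      · rintro ⟨h1, h2⟩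
        by_cases hzx : z = x
        · exact Or.inl hzx
        · have : left G z ≠ left G x := fun h => hzx (huniq z h1 h)
          exact Or.inr ⟨h1, hmax z ⟨h1, by omega⟩⟩
      · rintro (rfl | ⟨h1, h2⟩)
        · exact ⟨hx, le_rfl⟩
        · exact ⟨h1, by omega⟩
    have hc : (D.filter fun z => left G z ≤ left G p).card = m + 1 := by
      rw [hS, Finset.card_insert_of_notMem (by simp; omega)] at hm
      omega
    have hpx : p ≠ x := by rintro rfl; omega
    have hright := hD.right_lt_right hG hx hp.1 hpx hp.2.le
    have harc : Arc G p x := by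
      refine ⟨hp.2, ?_, hright⟩
      -- The `Y`-vertex just before the interval of `x` needs a neighbour in `D`. That neighbour
      -- begins before `x`, hence no later than `p`, hence ends no later than `p`, so there is no
      -- gap.
      by_contra! hgap
      have := hG.right_lt x
      have := hG.left_le_right x
      obtain ⟨y, hy, hyj⟩ := hG.isRedDominating_iff.1 hD.1 (left G x - 1) (by omega)
      have h1 := hmax y ⟨hy, by omega⟩
      by_cases hyp : y = p
      · subst hyp; omega
      · have := hD.right_lt_right hG hp.1 hy hyp h1
        omega
    have hP := ih hp.1 hc (by
      intro z hz hzp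
      by_contra hne
      have h1 := hD.right_lt_right hG hp.1 hz hne hzp.le
      have h2 := hD.right_lt_right hG hz hp.1 (Ne.symm hne) hzp.ge
      omega)
    refine ⟨?_, p, harc, _, hP, hS⟩
    have hle : L x ≤ (m + 1 : ℕ) := by
      have := hL.relax p x harc
      rw [hP.label_eq] at this
      exact_mod_cast this
    lift L x to ℕ using ne_top_of_le_ne_top (ENat.natCast_ne_top _) hle with j hj
    -- Relaxation along the arc gave `L x ≤ m + 1`; the exchange argument gives the opposite
    -- inequality.
    have h1 := hD.le_label hG hL hx hj.symm
    norm_cast at hle ⊢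
    omega

theorem IsMCRD.exists_pathSet (hG : IsLexConvex G) (hL : IsLabelling G L) {D : Finset (Fin nX)}
    (hD : IsMCRD G D) {n : ℕ} (hn : n + 1 = mcrdCard G) :
    ∃ x, Nbr G x (nY - 1) ∧ PathSet G L n x D := by
  obtain ⟨x, hx, hxj⟩ := hG.isRedDominating_iff.1 hD.1 (nY - 1) le_rfl
  refine ⟨x, hG.nbr_iff.2 hxj, ?_⟩
  have hall : (D.filter fun z => left G z ≤ left G x) = D := by
    rw [Finset.filter_eq_self]
    intro z hz
    by_contra! hlt
    have h1 := hD.right_lt_right hG hz hx (by rintro rfl; omega) hlt.le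
    have := hG.right_lt z
    omega
  have hc : D.card = n + 1 :=
    le_antisymm (hn ▸ (hG.isMCRD_iff.1 hD).2) (hn ▸ mcrdCard_le hD.1)
  have := hD.pathSet_filter hG hL (m := n) hx (by rw [hall, hc])
  rwa [hall] at this

theorem isMCRD_iff_exists_pathSet (hG : IsLexConvex G) (hL : IsLabelling G L)
    {D : Finset (Fin nX)} {n : ℕ} (hn : n + 1 = mcrdCard G) :
    IsMCRD G D ↔ ∃ x, Nbr G x (nY - 1) ∧ PathSet G L n x D :=
  ⟨fun h => h.exists_pathSet hG hL hn, fun ⟨_, hx, h⟩ => h.isMCRD hG hL hn hx⟩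

theorem exists_last_label (hG : IsLexConvex G) (hL : IsLabelling G L) {n : ℕ}
    (hn : n + 1 = mcrdCard G) : ∃ x, Nbr G x (nY - 1) ∧ L x = n := by
  obtain ⟨D, hD, -⟩ := hG.exists_isMCRD
  obtain ⟨x, hx, hP⟩ := hD.exists_pathSet hG hL hn
  exact ⟨x, hx, hP.label_eq⟩

theorem iInf_label_add_one (hG : IsLexConvex G) (hL : IsLabelling G L) :
    (⨅ x ∈ {x : Fin nX | Nbr G x (nY - 1)}, L x) + 1 = (mcrdCard G : ℕ∞) := by
  obtain ⟨n, hn⟩ := Nat.exists_eq_add_one.2 hG.mcrdCard_pos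
  have hinf : (⨅ x ∈ {x : Fin nX | Nbr G x (nY - 1)}, L x) = n := by
    apply le_antisymm
    · obtain ⟨x, hx, hxn⟩ := exists_last_label hG hL hn.symm
      exact (iInf₂_le x hx).trans hxn.le
    · refine le_iInf₂ fun x hx => ?_
      by_cases htop : L x = ⊤
      · simp [htop]
      · lift L x to ℕ using htop with j hj
        have := mcrdCard_le_label hG hL hx hj.symm
        norm_cast
        omega
  rw [hinf, hn]
  norm_cast

end Tight

section Runs

-- Gaps between outputs in a trace

section Paced

variable {α : Type*}

/-- In `t`, where `none` stands for one unit of time and `some` for an output, there is an output,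
at most `a` units of time pass before the first one, at most `b` after the last one, and at most
`B` without an output. -/
structure Paced (a b B : ℕ) (t : List (Option α)) : Prop where
  exists_output : t.reduceOption ≠ []
  prefix_le : ∀ v w, t = v ++ w → v.reduceOption = [] → v.length ≤ a
  suffix_le : ∀ u v, t = u ++ v → v.reduceOption = [] → v.length ≤ b
  infix_le : ∀ u v w, t = u ++ v ++ w → v.reduceOption = [] → v.length ≤ B

theorem paced_singleton (d : α) : Paced 0 0 0 [some d] := by
  have h : ∀ u v w : List (Option α), [some d] = u ++ v ++ w → v.reduceOption = [] →
      v.length ≤ 0 := by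
    intro u v w h hv
    have hlen := congrArg List.length h
    have hred := congrArg List.reduceOption h
    simp only [List.reduceOption_append, hv] at hred
    simp only [List.length_append, List.length_cons, List.length_nil] at hlen
    rcases v with _ | ⟨e, v⟩
    · simp
    · have hu : u = [] := List.length_eq_zero_iff.1 (by simp at hlen; omega)
      have hw : w = [] := List.length_eq_zero_iff.1 (by simp at hlen; omega)
      simp [hu, hw] at hred
  exact ⟨by simp, fun v w e => h [] v w (by simpa using e),
    fun u v e => h u v [] (by simpa using e), h⟩

theorem Paced.mono {a b B a' b' B' : ℕ} {t : List (Option α)} (h : Paced a b B t) (ha : a ≤ a')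
    (hb : b ≤ b') (hB : B ≤ B') : Paced a' b' B' t :=
  ⟨h.1, fun v w e hv => (h.2 v w e hv).trans ha, fun u v e hv => (h.3 u v e hv).trans hb,
    fun u v w e hv => (h.4 u v w e hv).trans hB⟩

/-- An infix of `t ++ t'` lies in `t`, lies in `t'`, or is a suffix of `t` followed by a prefix
of `t'`. -/
theorem infix_append_cases {t t' u v w : List α} (h : t ++ t' = u ++ v ++ w) :
    (∃ w', t = u ++ v ++ w') ∨ (∃ u', t' = u' ++ v ++ w) ∨
      ∃ v₁ v₂, v = v₁ ++ v₂ ∧ t = u ++ v₁ ∧ t' = v₂ ++ w := by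
  rcases List.append_eq_append_iff.1 h with ⟨s, hs, hs'⟩ | ⟨s, hs, hs'⟩
  · rcases List.append_eq_append_iff.1 hs with ⟨r, hr, hr'⟩ | ⟨r, hr, hr'⟩
    · exact Or.inr (Or.inr ⟨r, s, hr', hr, hs'⟩)
    · exact Or.inr (Or.inl ⟨r, by rw [hs', hr']⟩)
  · exact Or.inl ⟨s, hs⟩

/-- Since both parts contain an output, the only new silent stretch is a silent end of `t` followed
by a silent start of `t'`. Without `exists_output` silent stretches could add up over many parts. -/
theorem Paced.append {a b B a' b' : ℕ} {t t' : List (Option α)} (h : Paced a b B t)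
    (h' : Paced a' b' B t') (hB : b + a' ≤ B) : Paced a b' B (t ++ t') := by
  refine ⟨by simp [List.reduceOption_append, h.1], ?_, ?_, ?_⟩
  · intro v w e hv
    rcases List.append_eq_append_iff.1 e with ⟨s, hs, -⟩ | ⟨s, hs, -⟩
    · rw [hs, List.reduceOption_append] at hv
      exact absurd (List.append_eq_nil_iff.1 hv).1 h.1
    · exact h.2 v s hs hv
  · intro u v e hv
    rcases List.append_eq_append_iff.1 e with ⟨s, -, hs⟩ | ⟨s, -, hs⟩
    · exact h'.3 s v hs hv
    · rw [hs, List.reduceOption_append] at hv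
      exact absurd (List.append_eq_nil_iff.1 hv).2 h'.1
  · intro u v w e hv
    rcases infix_append_cases e with ⟨w', hw⟩ | ⟨u', hu⟩ | ⟨v₁, v₂, rfl, h1, h2⟩
    · exact h.4 u v w' hw hv
    · exact h'.4 u' v w hu hv
    · rw [List.reduceOption_append, List.append_eq_nil_iff] at hv
      have := h.3 u v₁ h1 hv.1
      have := h'.2 v₂ w h2 hv.2
      simp only [List.length_append]
      omega

theorem Paced.silent_append {a b B m : ℕ} {s t : List (Option α)} (h : Paced a b B t)
    (hs : s.reduceOption = []) (hm : s.length ≤ m) (hB : m + a ≤ B) :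
    Paced (m + a) b B (s ++ t) := by
  refine ⟨by simp [List.reduceOption_append, h.1], ?_, ?_, ?_⟩
  · intro v w e hv
    rcases List.append_eq_append_iff.1 e with ⟨r, rfl, hr⟩ | ⟨r, rfl, -⟩
    · rw [List.reduceOption_append, List.append_eq_nil_iff] at hv
      have := h.2 r w hr hv.2
      simp only [List.length_append]
      omega
    · simp only [List.length_append] at hm
      omega
  · intro u v e hv
    rcases List.append_eq_append_iff.1 e with ⟨r, -, hr⟩ | ⟨r, -, rfl⟩
    · exact h.3 r v hr hv
    · rw [List.reduceOption_append] at hv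
      exact absurd (List.append_eq_nil_iff.1 hv).2 h.1
  · intro u v w e hv
    rcases infix_append_cases e with ⟨w', rfl⟩ | ⟨u', hu⟩ | ⟨v₁, v₂, rfl, rfl, h2⟩
    · simp only [List.length_append] at hm
      omega
    · exact h.4 u' v w hu hv
    · rw [List.reduceOption_append, List.append_eq_nil_iff] at hv
      have := h.2 v₂ w h2 hv.2
      simp only [List.length_append] at hm ⊢
      omega

theorem Paced.append_silent {a b B m : ℕ} {s t : List (Option α)} (h : Paced a b B t)
    (hs : s.reduceOption = []) (hm : s.length ≤ m) (hB : b + m ≤ B) :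
    Paced a (b + m) B (t ++ s) := by
  refine ⟨by simp [List.reduceOption_append, h.1], ?_, ?_, ?_⟩
  · intro v w e hv
    rcases List.append_eq_append_iff.1 e with ⟨r, rfl, -⟩ | ⟨r, hr, -⟩
    · rw [List.reduceOption_append] at hv
      exact absurd (List.append_eq_nil_iff.1 hv).1 h.1
    · exact h.2 v r hr hv
  · intro u v e hv
    rcases List.append_eq_append_iff.1 e with ⟨r, rfl, rfl⟩ | ⟨r, hr, rfl⟩
    · simp only [List.length_append] at hm
      omega
    · rw [List.reduceOption_append, List.append_eq_nil_iff] at hv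
      have := h.3 u r hr hv.1
      simp only [List.length_append]
      omega
  · intro u v w e hv
    rcases infix_append_cases e with ⟨w', hw⟩ | ⟨u', rfl⟩ | ⟨v₁, v₂, rfl, h1, rfl⟩
    · exact h.4 u v w' hw hv
    · simp only [List.length_append] at hm
      omega
    · rw [List.reduceOption_append, List.append_eq_nil_iff] at hv
      have := h.3 u v₁ h1 hv.1
      simp only [List.length_append] at hm ⊢
      omega

end Paced

-- Correctness and call delay of the recursion

variable {nX nY : ℕ} {G : SimpleGraph (Fin nX ⊕ Fin nY)} {L : Fin nX → ℕ∞}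

theorem outputs_append (τ τ' : List (Event nX)) : outputs (τ ++ τ') = outputs τ ++ outputs τ' :=
  List.filterMap_append

theorem outputs_node (D : Finset (Fin nX)) (x : Fin nX) (τ : List (Event nX)) :
    outputs (Event.call D x :: (τ ++ [Event.ret])) = outputs τ := by
  simp [outputs, List.filterMap_cons, Event.output?]

theorem reduceOption_map_output (τ : List (Event nX)) :
    (τ.map Event.output?).reduceOption = outputs τ := by
  simp [List.reduceOption, outputs, List.filterMap_map]

theorem Paced.callDelayAtMost {a b B : ℕ} {τ : List (Event nX)}
    (h : Paced a b B (τ.map Event.output?)) : CallDelayAtMost B τ := by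
  intro u v w e hv
  have := h.4 (u.map Event.output?) (v.map Event.output?) (w.map Event.output?) (by simp [e])
    (by rw [reduceOption_map_output, hv])
  simpa using this

theorem PathSet.mem {n : ℕ} {x : Fin nX} {S : Finset (Fin nX)} (h : PathSet G L n x S) :
    x ∈ S := by
  cases n with
  | zero => simp [h.2]
  | succ n =>
    obtain ⟨-, x', -, S', -, rfl⟩ := h
    simp

theorem PathSet.eq_of_label {n : ℕ} {x y : Fin nX} {S : Finset (Fin nX)}
    (h : PathSet G L n x S) (hy : y ∈ S) (hyn : L y = n) : y = x := by
  cases n with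
  | zero => simpa [h.2] using hy
  | succ n =>
    obtain ⟨-, x', -, S', hS', rfl⟩ := h
    rcases Finset.mem_insert.1 hy with rfl | hy
    · rfl
    · have := hS'.label_le hy
      rw [hyn] at this
      norm_cast at this
      omega

theorem IsLexConvex.candidate_iff_label (hG : IsLexConvex G) {n : ℕ} {x x' : Fin nX}
    (hx : L x = (n + 1 : ℕ)) : Candidate G L x x' ↔ Arc G x' x ∧ L x' = n := by
  rw [hG.candidate_iff, hx, Nat.cast_add, Nat.cast_one]
  refine and_congr_right fun _ => ⟨fun h => ENat.add_left_injective_of_ne_top (by simp) h, ?_⟩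
  intro h
  rw [h]

theorem GenerateLoop.mem_outputs {n : ℕ}
    (ih : ∀ (D : Finset (Fin nX)) (x : Fin nX) (τ : List (Event nX)), L x = n → x ∈ D →
      Generate G L D x τ → ∀ D', D' ∈ outputs τ ↔ ∃ S, PathSet G L n x S ∧ D' = D ∪ S)
    {D : Finset (Fin nX)} {l : List (Fin nX)} {τ : List (Event nX)}
    (h : GenerateLoop G L D l τ) (hl : ∀ x ∈ l, L x = n) (D' : Finset (Fin nX)) :
    D' ∈ outputs τ ↔ ∃ x ∈ l, ∃ S, PathSet G L n x S ∧ D' = D ∪ S := by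
  induction l generalizing τ with
  | nil => cases h; simp [outputs]
  | cons x l ihl =>
    cases h with
    | cons _ _ _ τ τ' hx hτ' =>
    rw [outputs_append, List.mem_append, ih _ _ _ (hl x (by simp)) (by simp) hx,
      ihl hτ' fun y hy => hl y (by simp [hy])]
    simp only [List.mem_cons, exists_eq_or_imp]
    refine or_congr_left (exists_congr fun S => and_congr_right fun hS => ?_)
    have : insert x D ∪ S = D ∪ S := by
      rw [Finset.insert_union, Finset.insert_eq_of_mem (Finset.mem_union_right _ hS.mem)]
    rw [this]

theorem Generate.mem_outputs (hG : IsLexConvex G) {n : ℕ} {D : Finset (Fin nX)} {x : Fin nX}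
    {τ : List (Event nX)} (hx : L x = n) (hxD : x ∈ D) (h : Generate G L D x τ)
    (D' : Finset (Fin nX)) :
    D' ∈ outputs τ ↔ ∃ S, PathSet G L n x S ∧ D' = D ∪ S := by
  induction n generalizing D x τ D' with
  | zero =>
    cases h with
    | leaf _ _ h0 =>
      have : D ∪ {x} = D := Finset.union_eq_left.2 (by simpa using hxD)
      simp [outputs, Event.output?, PathSet, h0, this, eq_comm]
    | node _ _ l _ h0 => exact absurd (by simpa using hx) h0
  | succ n ih =>
    cases h with
    | leaf _ _ h0 => rw [h0] at hx; norm_cast at hx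
    | node _ _ l τ h0 hl hmem hloop =>
      have hcand : ∀ x', x' ∈ l ↔ Arc G x' x ∧ L x' = n := fun x' => by
        rw [hmem, hG.candidate_iff_label hx]
      rw [outputs_node, hloop.mem_outputs (fun D x τ hx hD hg D' => ih hx hD hg D')
        (fun y hy => ((hcand y).1 hy).2)]
      constructor
      · rintro ⟨y, hy, S, hS, rfl⟩
        refine ⟨insert x S, ⟨hx, y, ((hcand y).1 hy).1, S, hS, rfl⟩, ?_⟩
        rw [Finset.union_insert, Finset.insert_eq_of_mem (Finset.mem_union_left _ hxD)]
      · rintro ⟨_, ⟨-, y, hy, S, hS, rfl⟩, rfl⟩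
        refine ⟨y, (hcand y).2 ⟨hy, hS.label_eq⟩, S, hS, ?_⟩
        rw [Finset.union_insert, Finset.insert_eq_of_mem (Finset.mem_union_left _ hxD)]

/-- Labels in `D` exceed `n`, so an output contains exactly one vertex of label `n`, namely the loop
element that produced it. Different loop elements therefore give different sets. -/
theorem GenerateLoop.nodup_outputs (hG : IsLexConvex G) {n : ℕ}
    (ih : ∀ (D : Finset (Fin nX)) (x : Fin nX) (τ : List (Event nX)), L x = n → x ∈ D →
      (∀ y ∈ D, y ≠ x → (n : ℕ∞) < L y) → Generate G L D x τ → (outputs τ).Nodup)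
    {D : Finset (Fin nX)} {l : List (Fin nX)} {τ : List (Event nX)}
    (h : GenerateLoop G L D l τ) (hnd : l.Nodup) (hl : ∀ x ∈ l, L x = n)
    (hD : ∀ y ∈ D, (n : ℕ∞) < L y) : (outputs τ).Nodup := by
  induction l generalizing τ with
  | nil => cases h; simp [outputs]
  | cons x l ihl =>
    cases h with
    | cons _ _ _ τ τ' hx hτ' =>
    have hxn := hl x (by simp)
    have hln : ∀ y ∈ l, L y = n := fun y hy => hl y (by simp [hy])
    rw [outputs_append, List.nodup_append]
    refine ⟨ih _ _ _ hxn (by simp) ?_ hx, ihl hτ' (List.nodup_cons.1 hnd).2 hln, ?_⟩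
    · intro y hy hne
      exact hD y ((Finset.mem_insert.1 hy).resolve_left hne)
    · rintro D' hD' D'' hD'' rfl
      rw [hx.mem_outputs hG hxn (by simp)] at hD'
      rw [hτ'.mem_outputs (fun D x τ hx hD hg D' => hg.mem_outputs hG hx hD D') hln] at hD''
      obtain ⟨S, hS, rfl⟩ := hD'
      obtain ⟨z, hz, S', hS', he⟩ := hD''
      have hxz : x ∈ D ∪ S' := he ▸ by simp
      rcases Finset.mem_union.1 hxz with h1 | h1
      · exact (hxn ▸ hD x h1).false
      · rw [hS'.eq_of_label h1 hxn] at hnd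
        exact (List.nodup_cons.1 hnd).1 hz

theorem Generate.nodup_outputs (hG : IsLexConvex G) {n : ℕ} {D : Finset (Fin nX)} {x : Fin nX}
    {τ : List (Event nX)} (hx : L x = n) (hxD : x ∈ D)
    (hD : ∀ y ∈ D, y ≠ x → (n : ℕ∞) < L y) (h : Generate G L D x τ) : (outputs τ).Nodup := by
  induction n generalizing D x τ with
  | zero =>
    cases h with
    | leaf _ _ h0 => simp [outputs, List.filterMap_cons, Event.output?]
    | node _ _ l _ h0 => exact absurd (by simpa using hx) h0
  | succ n ih =>
    cases h with
    | leaf _ _ h0 => rw [h0] at hx; norm_cast at hx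
    | node _ _ l τ h0 hl hmem hloop =>
      rw [outputs_node]
      refine hloop.nodup_outputs hG (fun D x τ hx hD hDy hg => ih hx hD hDy hg) hl
        (fun y hy => ((hG.candidate_iff_label hx).1 ((hmem y).1 hy)).2) ?_
      have hlt : (n : ℕ∞) < (n + 1 : ℕ) := by norm_cast; omega
      intro y hy
      by_cases hyx : y = x
      · rw [hyx, hx]; exact hlt
      · exact hlt.trans (hD y hy hyx)

theorem IsLabelling.exists_candidate (hG : IsLexConvex G) (hL : IsLabelling G L) {n : ℕ}
    {x : Fin nX} (hx : L x = (n + 1 : ℕ)) : ∃ x', Candidate G L x x' := by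
  obtain ⟨p, hp⟩ := hL.exists_arc hx
  exact ⟨p, (hG.candidate_iff_label hx).2 hp⟩

theorem GenerateLoop.paced {n B : ℕ} (hB : 2 * (n + 1) ≤ B)
    (ih : ∀ (D : Finset (Fin nX)) (x : Fin nX) (τ : List (Event nX)), L x = n →
      Generate G L D x τ → Paced (n + 1) (n + 1) B (τ.map Event.output?))
    {D : Finset (Fin nX)} {l : List (Fin nX)} {τ : List (Event nX)}
    (h : GenerateLoop G L D l τ) (hl : ∀ x ∈ l, L x = n) (hne : l ≠ []) :
    Paced (n + 1) (n + 1) B (τ.map Event.output?) := by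
  induction l generalizing τ with
  | nil => exact absurd rfl hne
  | cons x l ihl =>
    cases h with
    | cons _ _ _ τ τ' hx hτ' =>
    have h1 := ih _ _ _ (hl x (by simp)) hx
    rw [List.map_append]
    rcases eq_or_ne l [] with rfl | hl'
    · cases hτ'
      simpa using h1
    · exact h1.append (ihl hτ' (fun y hy => hl y (by simp [hy])) hl') (by omega)

/-- Each level adds one call before and one return after a loop that is never empty. So at most `n +
1` events precede the first output or follow the last one, and `B` has to hold the sum of the two.
-/
theorem Generate.paced (hG : IsLexConvex G) (hL : IsLabelling G L) {n B : ℕ}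
    (hB : 2 * (n + 1) ≤ B) {D : Finset (Fin nX)} {x : Fin nX}
    {τ : List (Event nX)} (hx : L x = n) (h : Generate G L D x τ) :
    Paced (n + 1) (n + 1) B (τ.map Event.output?) := by
  induction n generalizing D x τ with
  | zero =>
    cases h with
    | leaf _ _ h0 =>
      have h1 := (((paced_singleton D).mono le_rfl le_rfl (Nat.zero_le B)).silent_append
        (s := [none]) (m := 1) (by simp) (by simp) (by omega)).append_silent
        (s := [none]) (m := 1) (by simp) (by simp) (by omega)
      exact h1.mono (by omega) (by omega) le_rfl
    | node _ _ l _ h0 => exact absurd (by simpa using hx) h0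
  | succ n ih =>
    cases h with
    | leaf _ _ h0 => rw [h0] at hx; norm_cast at hx
    | node _ _ l τ h0 hl hmem hloop =>
      obtain ⟨x', hx'⟩ := hL.exists_candidate hG hx
      have h1 := hloop.paced (n := n) (B := B) (by omega)
        (fun D x τ hx hg => ih (by omega) hx hg)
        (fun y hy => ((hG.candidate_iff_label hx).1 ((hmem y).1 hy)).2)
        (List.ne_nil_of_mem ((hmem x').2 hx'))
      have h2 := (h1.silent_append (s := [none]) (m := 1) (by simp) (by simp)
        (by omega)).append_silent (s := [none]) (m := 1) (by simp) (by simp) (by omega)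
      have h3 := h2.mono (a' := n + 1 + 1) (b' := n + 1 + 1) (by omega) (by omega) le_rfl
      simpa [Event.output?] using h3

/-- A set that extends `D` is output before any call returns. -/
def OutputsFirst (D : Finset (Fin nX)) (τ : List (Event nX)) : Prop :=
  ∃ (v w' : List (Event nX)) (D' : Finset (Fin nX)),
    τ = v ++ Event.output D' :: w' ∧ D ⊆ D' ∧ Event.ret ∉ v

theorem OutputsFirst.append {D : Finset (Fin nX)} {τ : List (Event nX)} (h : OutputsFirst D τ)
    (τ' : List (Event nX)) : OutputsFirst D (τ ++ τ') := by
  obtain ⟨v, w', D', rfl, h1, h2⟩ := h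
  exact ⟨v, w' ++ τ', D', by simp, h1, h2⟩

theorem OutputsFirst.call_cons {D : Finset (Fin nX)} {τ : List (Event nX)}
    (h : OutputsFirst D τ) (D₀ : Finset (Fin nX)) (x : Fin nX) :
    OutputsFirst D (Event.call D₀ x :: τ) := by
  obtain ⟨v, w', D', rfl, h1, h2⟩ := h
  exact ⟨Event.call D₀ x :: v, w', D', by simp, h1, by simp [h2]⟩

theorem NoFailedPartialSolution.append {τ τ' : List (Event nX)} (h : NoFailedPartialSolution τ)
    (h' : NoFailedPartialSolution τ') : NoFailedPartialSolution (τ ++ τ') := by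
  intro u w D x e
  rcases List.append_eq_append_iff.1 e with ⟨s, rfl, hs⟩ | ⟨s, hs, hs'⟩
  · exact h' s w D x hs
  · rcases s with _ | ⟨a, s⟩
    · exact h' [] w D x (by simpa using hs'.symm)
    · rw [List.cons_append, List.cons.injEq] at hs'
      obtain ⟨rfl, rfl⟩ := hs'
      exact OutputsFirst.append (h u s D x hs) τ'

theorem noFailedPartialSolution_of_forall {τ : List (Event nX)}
    (h : ∀ D x, Event.call D x ∉ τ) : NoFailedPartialSolution τ := by
  rintro u w D x rfl
  exact absurd (by simp) (h D x)

theorem NoFailedPartialSolution.call_cons {τ : List (Event nX)} (h : NoFailedPartialSolution τ)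
    {D : Finset (Fin nX)} (hD : OutputsFirst D τ) (x : Fin nX) :
    NoFailedPartialSolution (Event.call D x :: τ) := by
  intro u w D' x' e
  rcases u with _ | ⟨a, u⟩
  · simp only [List.nil_append, List.cons.injEq, Event.call.injEq] at e
    obtain ⟨⟨rfl, rfl⟩, rfl⟩ := e
    exact hD
  · simp only [List.cons_append, List.cons.injEq] at e
    exact h u w D' x' e.2

theorem GenerateLoop.noFailedPartialSolution {n : ℕ}
    (ih : ∀ (D : Finset (Fin nX)) (x : Fin nX) (τ : List (Event nX)), L x = n →
      Generate G L D x τ → NoFailedPartialSolution τ ∧ OutputsFirst D τ)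
    {D : Finset (Fin nX)} {l : List (Fin nX)} {τ : List (Event nX)}
    (h : GenerateLoop G L D l τ) (hl : ∀ x ∈ l, L x = n) :
    NoFailedPartialSolution τ ∧ (l ≠ [] → OutputsFirst D τ) := by
  induction l generalizing τ with
  | nil => cases h; exact ⟨noFailedPartialSolution_of_forall (by simp), by simp⟩
  | cons x l ihl =>
    cases h with
    | cons _ _ _ τ τ' hx hτ' =>
    have h1 := ih _ _ _ (hl x (by simp)) hx
    refine ⟨h1.1.append (ihl hτ' fun y hy => hl y (by simp [hy])).1, fun _ => ?_⟩
    obtain ⟨v, w, D', h2, h3, h4⟩ := h1.2.append τ'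
    exact ⟨v, w, D', h2, (Finset.subset_insert _ _).trans h3, h4⟩

theorem Generate.noFailedPartialSolution (hG : IsLexConvex G) (hL : IsLabelling G L) {n : ℕ}
    {D : Finset (Fin nX)} {x : Fin nX} {τ : List (Event nX)} (hx : L x = n)
    (h : Generate G L D x τ) : NoFailedPartialSolution τ ∧ OutputsFirst D τ := by
  induction n generalizing D x τ with
  | zero =>
    cases h with
    | leaf _ _ h0 =>
      have h1 : OutputsFirst D [Event.output D, Event.ret] := ⟨[], [Event.ret], D, by simp⟩
      exact ⟨(noFailedPartialSolution_of_forall (by simp)).call_cons h1 x, h1.call_cons D x⟩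
    | node _ _ l _ h0 => exact absurd (by simpa using hx) h0
  | succ n ih =>
    cases h with
    | leaf _ _ h0 => rw [h0] at hx; norm_cast at hx
    | node _ _ l τ h0 hl hmem hloop =>
      obtain ⟨x', hx'⟩ := hL.exists_candidate hG hx
      have h1 := hloop.noFailedPartialSolution (fun D x τ hx hg => ih hx hg)
        (fun y hy => ((hG.candidate_iff_label hx).1 ((hmem y).1 hy)).2)
      have h2 := (h1.2 (List.ne_nil_of_mem ((hmem x').2 hx'))).append [Event.ret]
      exact ⟨(h1.1.append (noFailedPartialSolution_of_forall (by simp))).call_cons h2 x,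
        h2.call_cons D x⟩

theorem EnumRun.spec (hG : IsLexConvex G) (hL : IsLabelling G L) {n : ℕ}
    (hn : n + 1 = mcrdCard G) {τ : List (Event nX)} (h : EnumRun G L n τ) :
    (outputs τ).Nodup ∧ (∀ D : Finset (Fin nX), D ∈ outputs τ ↔ IsMCRD G D) ∧
      NoFailedPartialSolution τ ∧ CallDelayAtMost (2 * mcrdCard G) τ := by
  obtain ⟨l, hnd, hmem, hloop⟩ := h
  have hl : ∀ x ∈ l, L x = n := fun x hx => ((hmem x).1 hx).2
  obtain ⟨x, hx⟩ := exists_last_label hG hL hn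
  refine ⟨?_, ?_, ?_, ?_⟩
  · exact hloop.nodup_outputs hG (fun D x τ hx hD hDy hg => hg.nodup_outputs hG hx hD hDy) hnd
      hl (by simp)
  · intro D
    rw [hloop.mem_outputs (fun D x τ hx hD hg D' => hg.mem_outputs hG hx hD D') hl,
      isMCRD_iff_exists_pathSet hG hL hn]
    simp only [Finset.empty_union, hmem]
    constructor
    · rintro ⟨x, ⟨hx, -⟩, S, hS, rfl⟩
      exact ⟨x, hx, hS⟩
    · rintro ⟨x, hx, hS⟩
      exact ⟨x, ⟨hx, hS.label_eq⟩, D, hS, rfl⟩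
  · exact (hloop.noFailedPartialSolution
      (fun D x τ hx hg => hg.noFailedPartialSolution hG hL hx) hl).1
  · exact (hloop.paced (B := 2 * mcrdCard G) (by omega)
      (fun D x τ hx hg => hg.paced hG hL (by omega) hx) hl
      (List.ne_nil_of_mem ((hmem x).2 hx))).callDelayAtMost

end Runs

-- Rules for timed, silent program execution

section Machine

/-! ### Silent executions -/

/-- `c` leads from `s` to `s'` within `T` units of time and without output. -/
def Silent (S W : ℕ) (c : Prog) (s : Store) (T : ℕ) (s' : Store) : Prop :=
  ∃ m ≤ T, Exec S W c s (List.replicate m none) s'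

namespace Silent

variable {S W T T' : ℕ} {c d : Prog} {e f : RExpr} {s s' s'' : Store}

theorem mono (h : Silent S W c s T s') (hT : T ≤ T') : Silent S W c s T' s' := by
  obtain ⟨m, hm, h⟩ := h
  exact ⟨m, hm.trans hT, h⟩

theorem seq (h : Silent S W c s T s') (h' : Silent S W d s' T' s'') :
    Silent S W (.seq c d) s (T + T') s'' := by
  obtain ⟨m, hm, h⟩ := h
  obtain ⟨m', hm', h'⟩ := h'
  refine ⟨m + m', by omega, ?_⟩
  rw [List.replicate_add]
  exact .seq _ _ _ _ _ _ _ h h'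

theorem ifTrue (h : e.eval s < f.eval s) (hc : Silent S W c s T s') :
    Silent S W (.ifLt e f c d) s (T + 1) s' := by
  obtain ⟨m, hm, hc⟩ := hc
  exact ⟨m + 1, by omega, .ifTrue _ _ _ _ _ _ _ h hc⟩

theorem ifFalse (h : ¬ e.eval s < f.eval s) (hd : Silent S W d s T s') :
    Silent S W (.ifLt e f c d) s (T + 1) s' := by
  obtain ⟨m, hm, hd⟩ := hd
  exact ⟨m + 1, by omega, .ifFalse _ _ _ _ _ _ _ h hd⟩

theorem whileTrue (h : e.eval s < f.eval s) (hc : Silent S W c s T s')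
    (hw : Silent S W (.whileLt e f c) s' T' s'') :
    Silent S W (.whileLt e f c) s (T + 1 + T') s'' := by
  obtain ⟨m, hm, hc⟩ := hc
  obtain ⟨m', hm', hw⟩ := hw
  refine ⟨m + m' + 1, by omega, ?_⟩
  rw [List.replicate_succ, List.replicate_add]
  exact .whileTrue _ _ _ _ _ _ _ _ h hc hw

theorem whileFalse (h : ¬ e.eval s < f.eval s) : Silent S W (.whileLt e f c) s 1 s :=
  ⟨1, le_rfl, .whileFalse _ _ _ _ h⟩

end Silent

/-! ### The memory layout -/

/-- The contents of the registers and arrays that are used. -/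
structure Cfg : Type where
  nX : ℕ
  nY : ℕ
  a : ℕ
  i : ℕ
  q : ℕ
  mode : ℕ
  d : ℕ
  lf : ℕ → ℕ
  rt : ℕ → ℕ
  lab : ℕ → ℕ
  nxt : ℕ → ℕ
  bh : ℕ → ℕ
  bn : ℕ → ℕ
  ch : ℕ → ℕ
  cn : ℕ → ℕ
  sol : ℕ → ℕ

/-- The store with the given contents. -/
def Cfg.store (c : Cfg) : Store where
  reg
    | 0 => c.nX
    | 1 => c.nY
    | 2 => c.a
    | 3 => c.i
    | 4 => c.q
    | 5 => c.mode
    | 6 => c.d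
    | _ => 0
  mem
    | 0 => c.lf
    | 1 => c.rt
    | 2 => c.lab
    | 3 => c.nxt
    | 4 => c.bh
    | 5 => c.bn
    | 6 => c.ch
    | 7 => c.cn
    | 8 => c.sol
    | _ => fun _ => 0

/-- The while rule: `Inv m c` says that the loop takes at most `m + 1` units of time from `c`
on. -/
theorem Silent.while {S W : ℕ} {e f : RExpr} {b : Prog} (Inv : ℕ → Cfg → Prop)
    (hstep : ∀ m c, Inv m c → e.eval c.store < f.eval c.store →
      ∃ c' T m', Silent S W b c.store T c'.store ∧ Inv m' c' ∧ T + 1 + m' ≤ m)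
    {m : ℕ} {c : Cfg} (h : Inv m c) :
    ∃ c' m', Silent S W (.whileLt e f b) c.store (m + 1) c'.store ∧ Inv m' c' ∧
      ¬ e.eval c'.store < f.eval c'.store := by
  induction m using Nat.strong_induction_on generalizing c with
  | _ m ih =>
    by_cases hg : e.eval c.store < f.eval c.store
    · obtain ⟨c', T, m', h1, h2, h3⟩ := hstep m c h hg
      obtain ⟨c'', m'', h4, h5, h6⟩ := ih m' (by omega) h2
      exact ⟨c'', m'', (Silent.whileTrue hg h1 h4).mono (by omega), h5, h6⟩
    · exact ⟨c, m, (Silent.whileFalse hg).mono (by omega), h, hg⟩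

section Rules

variable {S W : ℕ} {c : Cfg} {e i : RExpr} {v j : ℕ}

theorem Silent.assign {r : ℕ} {s s' : Store} (he : e.eval s ≤ W) (h1 : s'.reg r = e.eval s)
    (h2 : ∀ x, x ≠ r → s'.reg x = s.reg x) (h3 : s'.mem = s.mem) :
    Silent S W (.assign r e) s 1 s' := by
  have h : s' = ⟨Function.update s.reg r (e.eval s), s.mem⟩ := by
    rw [← h3, ← Function.eq_update_iff.2 ⟨h1, h2⟩]
  exact ⟨1, le_rfl, h ▸ .assign _ _ _ he⟩

theorem Silent.write {A : ℕ} {s s' : Store} (hi : i.eval s < S) (he : e.eval s ≤ W)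
    (h1 : s'.mem A = Function.update (s.mem A) (i.eval s) (e.eval s))
    (h2 : ∀ x, x ≠ A → s'.mem x = s.mem x) (h3 : s'.reg = s.reg) :
    Silent S W (.write A i e) s 1 s' := by
  have h : s' = ⟨s.reg,
      Function.update s.mem A (Function.update (s.mem A) (i.eval s) (e.eval s))⟩ := by
    rw [← h3, ← Function.eq_update_iff.2 ⟨h1, h2⟩]
  exact ⟨1, le_rfl, h ▸ .write _ _ _ _ hi he⟩

theorem Silent.assign_i (hv : e.eval c.store = v) (hW : v ≤ W) :
    Silent S W (.assign 3 e) c.store 1 { c with i := v }.store := by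
  subst hv
  refine .assign hW rfl ?_ rfl
  rintro (_ | _ | _ | _ | _ | _ | _ | x) hx <;> first | rfl | exact absurd rfl hx

theorem Silent.assign_q (hv : e.eval c.store = v) (hW : v ≤ W) :
    Silent S W (.assign 4 e) c.store 1 { c with q := v }.store := by
  subst hv
  refine .assign hW rfl ?_ rfl
  rintro (_ | _ | _ | _ | _ | _ | _ | x) hx <;> first | rfl | exact absurd rfl hx

theorem Silent.assign_mode (hv : e.eval c.store = v) (hW : v ≤ W) :
    Silent S W (.assign 5 e) c.store 1 { c with mode := v }.store := by
  subst hv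
  refine .assign hW rfl ?_ rfl
  rintro (_ | _ | _ | _ | _ | _ | _ | x) hx <;> first | rfl | exact absurd rfl hx

theorem Silent.assign_d (hv : e.eval c.store = v) (hW : v ≤ W) :
    Silent S W (.assign 6 e) c.store 1 { c with d := v }.store := by
  subst hv
  refine .assign hW rfl ?_ rfl
  rintro (_ | _ | _ | _ | _ | _ | _ | x) hx <;> first | rfl | exact absurd rfl hx

theorem Silent.write_lf (hj : i.eval c.store = j) (hS : j < S)
    (hv : e.eval c.store = v) (hW : v ≤ W) :
    Silent S W (.write 0 i e) c.store 1
      { c with lf := Function.update c.lf j v }.store := by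
  subst hv hj
  refine .write hS hW rfl ?_ rfl
  rintro (_ | _ | _ | _ | _ | _ | _ | _ | _ | x) hx <;> first | rfl | exact absurd rfl hx

theorem Silent.write_nxt (hj : i.eval c.store = j) (hS : j < S)
    (hv : e.eval c.store = v) (hW : v ≤ W) :
    Silent S W (.write 3 i e) c.store 1
      { c with nxt := Function.update c.nxt j v }.store := by
  subst hv hj
  refine .write hS hW rfl ?_ rfl
  rintro (_ | _ | _ | _ | _ | _ | _ | _ | _ | x) hx <;> first | rfl | exact absurd rfl hx

theorem Silent.write_bh (hj : i.eval c.store = j) (hS : j < S)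
    (hv : e.eval c.store = v) (hW : v ≤ W) :
    Silent S W (.write 4 i e) c.store 1
      { c with bh := Function.update c.bh j v }.store := by
  subst hv hj
  refine .write hS hW rfl ?_ rfl
  rintro (_ | _ | _ | _ | _ | _ | _ | _ | _ | x) hx <;> first | rfl | exact absurd rfl hx

theorem Silent.write_bn (hj : i.eval c.store = j) (hS : j < S)
    (hv : e.eval c.store = v) (hW : v ≤ W) :
    Silent S W (.write 5 i e) c.store 1
      { c with bn := Function.update c.bn j v }.store := by
  subst hv hj
  refine .write hS hW rfl ?_ rfl
  rintro (_ | _ | _ | _ | _ | _ | _ | _ | _ | x) hx <;> first | rfl | exact absurd rfl hx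

theorem Silent.write_ch (hj : i.eval c.store = j) (hS : j < S)
    (hv : e.eval c.store = v) (hW : v ≤ W) :
    Silent S W (.write 6 i e) c.store 1
      { c with ch := Function.update c.ch j v }.store := by
  subst hv hj
  refine .write hS hW rfl ?_ rfl
  rintro (_ | _ | _ | _ | _ | _ | _ | _ | _ | x) hx <;> first | rfl | exact absurd rfl hx

theorem Silent.write_cn (hj : i.eval c.store = j) (hS : j < S)
    (hv : e.eval c.store = v) (hW : v ≤ W) :
    Silent S W (.write 7 i e) c.store 1
      { c with cn := Function.update c.cn j v }.store := by
  subst hv hj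
  refine .write hS hW rfl ?_ rfl
  rintro (_ | _ | _ | _ | _ | _ | _ | _ | _ | x) hx <;> first | rfl | exact absurd rfl hx

theorem Silent.write_sol (hj : i.eval c.store = j) (hS : j < S)
    (hv : e.eval c.store = v) (hW : v ≤ W) :
    Silent S W (.write 8 i e) c.store 1
      { c with sol := Function.update c.sol j v }.store := by
  subst hv hj
  refine .write hS hW rfl ?_ rfl
  rintro (_ | _ | _ | _ | _ | _ | _ | _ | _ | x) hx <;> first | rfl | exact absurd rfl hx

end Rules

/-! ### Linked lists -/

/-- The linked list with head pointer `h` has the entries of the list; a pointer to `x` is stored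
as `x + 1`, and `0` is the null pointer. -/
def Linked (next : ℕ → ℕ) : ℕ → List ℕ → Prop
  | h, [] => h = 0
  | h, x :: l => h = x + 1 ∧ Linked next (next x) l

theorem Linked.update {next : ℕ → ℕ} {h : ℕ} {l : List ℕ} (hl : Linked next h l) {p v : ℕ}
    (hp : p ∉ l) : Linked (Function.update next p v) h l := by
  induction l generalizing h with
  | nil => exact hl
  | cons x l ih =>
    simp only [List.mem_cons, not_or] at hp
    refine ⟨hl.1, ?_⟩
    rw [Function.update_of_ne (Ne.symm hp.1)]
    exact ih hl.2 hp.2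

/-- Inserting `p` at the front of one of the lists, which are given by the values of `key`. -/
theorem Linked.push {next head key : ℕ → ℕ} {l : List ℕ} {p : ℕ} (hp : p ∉ l)
    (h : ∀ b, Linked next (head b) (l.filter (key · = b))) (b : ℕ) :
    Linked (Function.update next p (head (key p))) (Function.update head (key p) (p + 1) b)
      ((p :: l).filter (key · = b)) := by
  have hp' : ∀ b, p ∉ l.filter (key · = b) := fun b hb => hp (List.mem_filter.1 hb).1
  by_cases hb : key p = b
  · subst hb
    rw [List.filter_cons_of_pos (by simp)]
    refine ⟨by simp, ?_⟩
    rw [Function.update_self]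
    exact (h _).update (hp' _)
  · rw [List.filter_cons_of_neg (by simpa using hb), Function.update_of_ne (Ne.symm hb)]
    exact (h b).update (hp' b)

end Machine

-- Linear-time preprocessing by bucket sort

section Sorting

/-! ### Sorting the label classes -/

/-- Nonempty intervals, numbered by increasing left end, followed by two sentinels. -/
structure SortedIntervals (n ny : ℕ) (lf rt lab : ℕ → ℕ) : Prop where
  last : lf n = ny
  sentinel : lf (n + 1) = ny + 1
  le_succ : ∀ i ≤ n, lf i ≤ lf (i + 1)
  le : ∀ i < n, lf i ≤ rt i
  lt : ∀ i < n, rt i < ny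
  lab_le : ∀ i < n, lab i ≤ n

theorem SortedIntervals.mono {n ny : ℕ} {lf rt lab : ℕ → ℕ} (h : SortedIntervals n ny lf rt lab)
    {i j : ℕ} (hij : i ≤ j) (hj : j ≤ n + 1) : lf i ≤ lf j := by
  induction j, hij using Nat.le_induction with
  | base => exact le_rfl
  | succ j _ ih => exact (ih (by omega)).trans (h.le_succ j (by omega))

/-- The first index whose interval begins after the end of the interval of `x`, with a gap. -/
noncomputable def bucketOf (lf rt : ℕ → ℕ) (x : ℕ) : ℕ := sInf {q | rt x + 2 ≤ lf q}

theorem lt_of_lt_bucketOf {lf rt : ℕ → ℕ} {x j : ℕ} (hj : j < bucketOf lf rt x) :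
    lf j < rt x + 2 := by
  have := Nat.notMem_of_lt_sInf hj
  simpa using this

theorem bucketOf_eq {lf rt : ℕ → ℕ} {x q : ℕ} (h : rt x + 2 ≤ lf q)
    (h' : ∀ j < q, lf j < rt x + 2) : bucketOf lf rt x = q := by
  refine le_antisymm (Nat.sInf_le h) ?_
  by_contra! hlt
  have h1 : rt x + 2 ≤ lf (bucketOf lf rt x) :=
    Nat.sInf_mem (s := {q | rt x + 2 ≤ lf q}) ⟨q, h⟩
  have h2 := h' _ hlt
  omega

namespace SortedIntervals

variable {n ny : ℕ} {lf rt lab : ℕ → ℕ} (h : SortedIntervals n ny lf rt lab)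
include h

theorem bucketOf_le {x : ℕ} (hx : x < n) : bucketOf lf rt x ≤ n + 1 := by
  refine Nat.sInf_le ?_
  have := h.lt x hx
  have := h.sentinel
  simp only [Set.mem_ofPred_eq]
  omega

/-- As left ends increase with the index, the bucket decides every test `lf j < rt x + 2`, so
sorting by bucket is as good as sorting by right end. The second sentinel ensures that the defining
set is nonempty even when `rt x + 1 = ny`. -/
theorem lt_bucketOf_iff {x j : ℕ} (hx : x < n) (hj : j ≤ n + 1) :
    j < bucketOf lf rt x ↔ lf j < rt x + 2 := by
  refine ⟨lt_of_lt_bucketOf, fun hlt => ?_⟩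
  by_contra! hle
  have h1 : rt x + 2 ≤ lf (bucketOf lf rt x) := by
    refine Nat.sInf_mem (s := {q | rt x + 2 ≤ lf q}) ⟨n + 1, ?_⟩
    have := h.lt x hx
    have := h.sentinel
    simp only [Set.mem_ofPred_eq]
    omega
  have := h.mono hle hj
  omega

end SortedIntervals

/-- `v` is the first index whose interval begins after that of `j`. -/
def NextLeft (n : ℕ) (lf : ℕ → ℕ) (j v : ℕ) : Prop :=
  v ≤ n + 1 ∧ lf j < lf v ∧ ∀ m < v, lf m ≤ lf j

/-- Find the bucket of the interval in register 3. -/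
def walkLoop : Prog :=
  .whileLt (.read 0 (.reg 4)) (.plus (.read 1 (.reg 3)) (.const 2)) (.assign 4 (.read 3 (.reg 4)))

/-- Following `nxt` skips equal left ends, so every jump strictly raises `lf`. Hence there are at
most `rt x + 2 - lf x` jumps, one more than the degree of `x`; stepping through the indices one by
one would not have this bound. -/
theorem walkLoop_spec {n ny S W : ℕ} {lf rt lab : ℕ → ℕ} (h : SortedIntervals n ny lf rt lab)
    (hW : n + 1 ≤ W) {x : ℕ} (hx : x < n) {c : Cfg} (hlf : c.lf = lf) (hrt : c.rt = rt)
    (hi : c.i = x) (hq : c.q = x)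
    (hnxt : ∀ j, x ≤ j → j ≤ n → NextLeft n lf j (c.nxt j)) :
    Silent S W walkLoop c.store (2 * (rt x + 2 - lf x) + 1)
      { c with q := bucketOf lf rt x }.store := by
  have hxr := h.le x hx
  have hrn := h.lt x hx
  have hs := h.sentinel
  have key := Silent.while (S := S) (W := W) (e := .read 0 (.reg 4))
    (f := .plus (.read 1 (.reg 3)) (.const 2)) (b := .assign 4 (.read 3 (.reg 4)))
    (fun m c' => ∃ q, c' = { c with q := q } ∧ q ≤ n + 1 ∧ x ≤ q ∧
      (∀ j < q, lf j < rt x + 2) ∧ m = 2 * (rt x + 2 - lf q))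
    (by
      rintro m c' ⟨q, rfl, hqn, hxq, hlt, rfl⟩ hg
      have hg' : lf q < rt x + 2 := by
        have : c.lf q < c.rt c.i + 2 := hg
        rwa [hlf, hrt, hi] at this
      have hqn' : q ≤ n := by
        by_contra! hc
        have : q = n + 1 := by omega
        subst this
        omega
      obtain ⟨h1, h2, h3⟩ := hnxt q hxq hqn'
      have hq : q < c.nxt q := by
        by_contra! hc
        have := h.mono hc (by omega)
        omega
      refine ⟨_, 1, _, Silent.assign_q (v := c.nxt q) rfl (by omega),
        ⟨c.nxt q, rfl, h1, by omega, fun j hj => (h3 j hj).trans_lt hg', rfl⟩, by omega⟩)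
    (c := c) ⟨x, by rw [← hq], by omega, le_rfl,
      fun j hj => by have := h.mono hj.le (by omega); omega, rfl⟩
  obtain ⟨c', m', h1, ⟨q, rfl, h2, h3, h4, h5⟩, h6⟩ := key
  have h6' : ¬ lf q < rt x + 2 := by
    have : ¬ c.lf q < c.rt c.i + 2 := h6
    rwa [hlf, hrt, hi] at this
  rw [bucketOf_eq (by omega) h4]
  exact h1

/-- Process one interval: find the next interval with a larger left end, and put the interval
into its bucket. -/
def bucketBody : Prog :=
  .seq (.assign 3 (.minus (.reg 3) (.const 1)))
    (.seq
      (.ifLt (.read 0 (.reg 3)) (.read 0 (.plus (.reg 3) (.const 1)))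
        (.write 3 (.reg 3) (.plus (.reg 3) (.const 1)))
        (.write 3 (.reg 3) (.read 3 (.plus (.reg 3) (.const 1)))))
      (.seq (.assign 4 (.reg 3))
        (.seq walkLoop
          (.seq (.write 5 (.reg 3) (.read 4 (.reg 4)))
            (.write 4 (.reg 4) (.plus (.reg 3) (.const 1)))))))

/-- Put all intervals into buckets. -/
def bucketLoop : Prog := .whileLt (.const 0) (.reg 3) bucketBody

/-- The invariant of `bucketLoop`. -/
def BucketInv (n : ℕ) (lf rt : ℕ → ℕ) (c₀ c : Cfg) : Prop :=
  ∃ i q nxt bh bn, c = { c₀ with i := i, q := q, nxt := nxt, bh := bh, bn := bn } ∧ i ≤ n ∧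
    (∀ j, i ≤ j → j ≤ n → NextLeft n lf j (nxt j)) ∧
    ∀ b, Linked bn (bh b) ((List.range' i (n - i)).filter (bucketOf lf rt · = b))

theorem bucketBody_spec {n ny S W : ℕ} {lf rt lab : ℕ → ℕ} (h : SortedIntervals n ny lf rt lab)
    (hS : n + 1 < S) (hW : n + 1 ≤ W) {c₀ c : Cfg} (hlf : c₀.lf = lf) (hrt : c₀.rt = rt)
    (hc : BucketInv n lf rt c₀ c) (hpos : 0 < c.i) :
    ∃ c', Silent S W bucketBody c.store (2 * (rt (c.i - 1) + 2 - lf (c.i - 1)) + 7) c'.store ∧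
      BucketInv n lf rt c₀ c' ∧ c'.i = c.i - 1 := by
  obtain ⟨i, q, nxt, bh, bn, rfl, hin, hnxt, hl⟩ := hc
  dsimp only at hpos ⊢
  obtain ⟨x, rfl⟩ : ∃ x, i = x + 1 := ⟨i - 1, by omega⟩
  rw [Nat.add_sub_cancel]
  have hx : x < n := by omega
  have hbx := h.bucketOf_le hx
  have hls := h.le_succ x hx.le
  set w := if lf x < lf (x + 1) then x + 1 else nxt (x + 1) with hw
  -- The pointer of `x` is computed from right to left: if `x + 1` has the same left end, its
  -- pointer is reused.
  have hxw : NextLeft n lf x w := by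
    by_cases hlt : lf x < lf (x + 1)
    · rw [hw, if_pos hlt]
      exact ⟨by omega, hlt, fun m hm => h.mono (by omega) (by omega)⟩
    · rw [hw, if_neg hlt]
      obtain ⟨h1, h2, h3⟩ := hnxt (x + 1) le_rfl (by omega)
      exact ⟨h1, by omega, fun m hm => (h3 m hm).trans (by omega)⟩
  have hwW : w ≤ W := hxw.1.trans hW
  set nxt' := Function.update nxt x w with hnxt'
  have hnxtok : ∀ j, x ≤ j → j ≤ n → NextLeft n lf j (nxt' j) := by
    intro j hj hjn
    by_cases hjx : j = x
    · subst hjx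
      rw [hnxt', Function.update_self]
      exact hxw
    · rw [hnxt', Function.update_of_ne hjx]
      exact hnxt j (by omega) hjn
  let c1 : Cfg := { c₀ with i := x, q := q, nxt := nxt, bh := bh, bn := bn }
  let c2 : Cfg := { c₀ with i := x, q := q, nxt := nxt', bh := bh, bn := bn }
  let c3 : Cfg := { c₀ with i := x, q := x, nxt := nxt', bh := bh, bn := bn }
  let p := bucketOf lf rt x
  let c4 : Cfg := { c₀ with i := x, q := p, nxt := nxt', bh := bh, bn := bn }
  let bn' := Function.update bn x (bh p)
  let c5 : Cfg := { c₀ with i := x, q := p, nxt := nxt', bh := bh, bn := bn' }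
  let bh' := Function.update bh p (x + 1)
  let c6 : Cfg := { c₀ with i := x, q := p, nxt := nxt', bh := bh', bn := bn' }
  have hpush := Linked.push (next := bn) (head := bh) (key := bucketOf lf rt)
    (l := List.range' (x + 1) (n - (x + 1))) (p := x) (by simp) hl
  have hrange : List.range' x (n - x) = x :: List.range' (x + 1) (n - (x + 1)) := by
    rw [show n - x = (n - (x + 1)) + 1 by omega, List.range'_succ]
  rw [← hrange] at hpush
  refine ⟨c6, ?_, ⟨x, p, nxt', bh', bn', rfl, hx.le, hnxtok, hpush⟩, rfl⟩
  have s1 : Silent S W (.assign 3 (.minus (.reg 3) (.const 1)))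
      ({ c₀ with i := x + 1, q := q, nxt := nxt, bh := bh, bn := bn } : Cfg).store 1 c1.store :=
    Silent.assign_i (v := x) rfl (by omega)
  have s2 : Silent S W (.ifLt (.read 0 (.reg 3)) (.read 0 (.plus (.reg 3) (.const 1)))
        (.write 3 (.reg 3) (.plus (.reg 3) (.const 1)))
        (.write 3 (.reg 3) (.read 3 (.plus (.reg 3) (.const 1))))) c1.store (1 + 1) c2.store := by
    by_cases hlt : lf x < lf (x + 1)
    · refine Silent.ifTrue (by rw [← hlf] at hlt; exact hlt) ?_
      have : w = x + 1 := by rw [hw, if_pos hlt]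
      exact Silent.write_nxt (c := c1) rfl (by omega) this.symm hwW
    · refine Silent.ifFalse (by rw [← hlf] at hlt; exact hlt) ?_
      have : w = nxt (x + 1) := by rw [hw, if_neg hlt]
      exact Silent.write_nxt (c := c1) rfl (by omega) this.symm hwW
  have s3 : Silent S W (.assign 4 (.reg 3)) c2.store 1 c3.store :=
    Silent.assign_q (c := c2) rfl (by omega)
  have s4 : Silent S W walkLoop c3.store (2 * (rt x + 2 - lf x) + 1) c4.store :=
    walkLoop_spec h hW hx (c := c3) hlf hrt rfl rfl hnxtok
  -- A list head is null or `y + 1` for an entry `y`; this keeps the stored number within the word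
  -- bound.
  have hbp : bh p ≤ W := by
    have := hl p
    rcases hb : (List.range' (x + 1) (n - (x + 1))).filter (bucketOf lf rt · = p) with _ | ⟨y, l⟩
    · rw [hb] at this
      rw [show bh p = 0 from this]
      omega
    · have hy : y ∈ (List.range' (x + 1) (n - (x + 1))).filter (bucketOf lf rt · = p) := by
        rw [hb]; simp
      rw [hb] at this
      rw [this.1]
      simp only [List.mem_filter, List.mem_range'_1] at hy
      omega
  have s5 : Silent S W (.write 5 (.reg 3) (.read 4 (.reg 4))) c4.store 1 c5.store :=
    Silent.write_bn (c := c4) rfl (by omega) rfl hbp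
  have s6 : Silent S W (.write 4 (.reg 4) (.plus (.reg 3) (.const 1))) c5.store 1 c6.store :=
    Silent.write_bh (c := c5) rfl (by omega) rfl (by omega)
  exact (s1.seq (s2.seq (s3.seq (s4.seq (s5.seq s6))))).mono (by omega)

theorem bucketLoop_spec {n ny S W : ℕ} {lf rt lab : ℕ → ℕ} (h : SortedIntervals n ny lf rt lab)
    (hS : n + 1 < S) (hW : n + 1 ≤ W) {c : Cfg} (hlf : c.lf = lf) (hrt : c.rt = rt)
    (hi : c.i = n) (hnxt : c.nxt n = n + 1) (hbh : c.bh = fun _ => 0) :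
    ∃ q nxt bh bn, Silent S W bucketLoop c.store
        (∑ j ∈ Finset.range n, (2 * (rt j + 2 - lf j) + 8) + 1)
        { c with i := 0, q := q, nxt := nxt, bh := bh, bn := bn }.store ∧
      ∀ b, Linked bn (bh b) ((List.range n).filter (bucketOf lf rt · = b)) := by
  have key := Silent.while (S := S) (W := W) (e := .const 0) (f := .reg 3) (b := bucketBody)
    (fun m c' => BucketInv n lf rt c c' ∧
      m = ∑ j ∈ Finset.range c'.i, (2 * (rt j + 2 - lf j) + 8))
    (by
      rintro m c' ⟨hc', rfl⟩ hg
      have hpos : 0 < c'.i := hg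
      obtain ⟨c'', h1, h2, h3⟩ := bucketBody_spec h hS hW hlf hrt hc' hpos
      refine ⟨c'', _, _, h1, ⟨h2, rfl⟩, ?_⟩
      rw [h3]
      obtain ⟨x, hx⟩ : ∃ x, c'.i = x + 1 := ⟨c'.i - 1, by omega⟩
      rw [hx, Finset.sum_range_succ, Nat.add_sub_cancel]
      omega)
    (c := c) ⟨⟨n, c.q, c.nxt, c.bh, c.bn, by rw [← hi], le_rfl, by
      intro j hj hjn
      obtain rfl : j = n := by omega
      rw [hnxt]
      have := h.last
      have := h.sentinel
      exact ⟨le_rfl, by omega, fun m hm => h.mono (by omega) (by omega)⟩, by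
      intro b
      simp [hbh, Linked]⟩, rfl⟩
  obtain ⟨c', m', h1, ⟨⟨i, q, nxt, bh, bn, rfl, h2, h3, h4⟩, -⟩, h5⟩ := key
  have hi0 : i = 0 := by
    have : ¬ 0 < i := h5
    omega
  subst hi0
  refine ⟨q, nxt, bh, bn, ?_, fun b => ?_⟩
  · rw [hi] at h1
    exact h1
  · rw [List.range_eq_range']
    exact h4 b

/-- Move the entries of a bucket to the lists of their label classes. -/
def drainLoop : Prog :=
  .whileLt (.const 0) (.reg 4)
    (.seq (.write 7 (.minus (.reg 4) (.const 1)) (.read 6 (.read 2 (.minus (.reg 4) (.const 1)))))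
      (.seq (.write 6 (.read 2 (.minus (.reg 4) (.const 1))) (.reg 4))
        (.assign 4 (.read 5 (.minus (.reg 4) (.const 1))))))

/-- Entries are pushed to the front, so a class list is the reverse of the order of processing.
Bucket links and class links are kept in separate arrays, so the bucket can still be followed while
it is emptied. -/
theorem drainLoop_spec {n S W : ℕ} {lab : ℕ → ℕ} (hlab : ∀ i < n, lab i ≤ n)
    (hS : n + 1 < S) (hW : n + 1 ≤ W) {c : Cfg} (hcl : c.lab = lab) {l rest : List ℕ}
    (hnd : (l ++ rest).Nodup) (hlt : ∀ x ∈ l ++ rest, x < n)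
    (hcn : ∀ b, Linked c.cn (c.ch b) (l.reverse.filter (lab · = b)))
    (hbn : Linked c.bn c.q rest) :
    ∃ ch cn, Silent S W drainLoop c.store (4 * rest.length + 1)
        { c with q := 0, ch := ch, cn := cn }.store ∧
      ∀ b, Linked cn (ch b) ((l ++ rest).reverse.filter (lab · = b)) := by
  induction rest generalizing c l with
  | nil =>
    have hq : c.q = 0 := hbn
    refine ⟨c.ch, c.cn, ?_, by simpa using hcn⟩
    have e : ({ c with q := 0, ch := c.ch, cn := c.cn } : Cfg) = c := by rw [← hq]
    rw [e]
    refine (Silent.whileFalse ?_).mono (by simp)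
    change ¬ 0 < c.q
    omega
  | cons x rest ih =>
    obtain ⟨hq, hbn'⟩ := hbn
    have hx : x < n := hlt x (by simp)
    have hlx := hlab x hx
    have hxl : x ∉ l.reverse := by
      intro hmem
      exact (List.disjoint_of_nodup_append hnd) (List.mem_reverse.1 hmem) (by simp)
    have hrest : ∀ y ∈ rest, y < n := fun y hy => hlt y (by simp [hy])
    have hpush := Linked.push hxl hcn
    have hrev : x :: l.reverse = (l ++ [x]).reverse := by simp
    rw [hrev] at hpush
    set cn' := Function.update c.cn x (c.ch (lab x)) with hcn'
    set ch' := Function.update c.ch (lab x) (x + 1) with hch'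
    have happ : l ++ x :: rest = (l ++ [x]) ++ rest := by simp
    rw [happ] at hnd hlt ⊢
    obtain ⟨ch, cn, h1, h2⟩ := ih (c := { c with q := c.bn x, cn := cn', ch := ch' }) (l := l ++ [x])
      hcl hnd hlt hpush hbn'
    refine ⟨ch, cn, ?_, h2⟩
    have hch : c.ch (lab x) ≤ W := by
      have := hcn (lab x)
      rcases hb : l.reverse.filter (lab · = lab x) with _ | ⟨y, l'⟩
      · rw [hb] at this
        rw [show c.ch (lab x) = 0 from this]
        omega
      · have hy : y ∈ l.reverse.filter (lab · = lab x) := by rw [hb]; simp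
        rw [hb] at this
        rw [this.1]
        simp only [List.mem_filter, List.mem_reverse] at hy
        have := hlt y (by simp [hy.1])
        omega
    have hb : c.bn x ≤ W := by
      rcases rest with _ | ⟨y, rest⟩
      · rw [show c.bn x = 0 from hbn']
        omega
      · rw [hbn'.1]
        have := hrest y (by simp)
        omega
    have hidx : (RExpr.minus (.reg 4) (.const 1)).eval c.store = x := by
      change c.q - 1 = x
      omega
    have e1 : (RExpr.minus (.reg 4) (.const 1)).eval ({ c with cn := cn' } : Cfg).store = x := hidx
    have e2 : (RExpr.minus (.reg 4) (.const 1)).eval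
      ({ c with cn := cn', ch := ch' } : Cfg).store = x := hidx
    have s1 : Silent S W (.write 7 (.minus (.reg 4) (.const 1))
        (.read 6 (.read 2 (.minus (.reg 4) (.const 1))))) c.store 1
        ({ c with cn := cn' } : Cfg).store := by
      refine Silent.write_cn hidx (by omega) ?_ hch
      rw [RExpr.eval, RExpr.eval, hidx]
      change c.ch (c.lab x) = _
      rw [hcl]
    have s2 : Silent S W (.write 6 (.read 2 (.minus (.reg 4) (.const 1))) (.reg 4))
        ({ c with cn := cn' } : Cfg).store 1 ({ c with cn := cn', ch := ch' } : Cfg).store := by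
      refine Silent.write_ch (c := { c with cn := cn' }) (j := lab x) ?_ (by omega) hq (by omega)
      rw [RExpr.eval, e1]
      change c.lab x = _
      rw [hcl]
    have s3 : Silent S W (.assign 4 (.read 5 (.minus (.reg 4) (.const 1))))
        ({ c with cn := cn', ch := ch' } : Cfg).store 1
        ({ c with q := c.bn x, cn := cn', ch := ch' } : Cfg).store := by
      refine Silent.assign_q (c := { c with cn := cn', ch := ch' }) ?_ hb
      rw [RExpr.eval, e2]
      rfl
    refine (Silent.whileTrue ?_ (s1.seq (s2.seq s3)) h1).mono ?_
    · change 0 < c.q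
      omega
    · simp only [List.length_cons]
      omega

/-- Move the contents of all buckets to the lists of the label classes. -/
def sortLoop : Prog :=
  .whileLt (.reg 3) (.plus (.reg 0) (.const 2))
    (.seq (.assign 4 (.read 4 (.reg 3)))
      (.seq drainLoop (.assign 3 (.plus (.reg 3) (.const 1)))))

/-- The indices with bucket less than `i`, by increasing bucket. -/
noncomputable def bucketSort (n : ℕ) (key : ℕ → ℕ) (i : ℕ) : List ℕ :=
  (List.range i).flatMap fun b => (List.range n).filter (key · = b)

theorem mem_bucketSort {n : ℕ} {key : ℕ → ℕ} {i x : ℕ} :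
    x ∈ bucketSort n key i ↔ x < n ∧ key x < i := by
  simp only [bucketSort, List.mem_flatMap, List.mem_range, List.mem_filter, decide_eq_true_eq]
  constructor
  · rintro ⟨b, hb, hx, rfl⟩
    exact ⟨hx, hb⟩
  · rintro ⟨hx, hb⟩
    exact ⟨_, hb, hx, rfl⟩

theorem bucketSort_succ (n : ℕ) (key : ℕ → ℕ) (i : ℕ) :
    bucketSort n key (i + 1) = bucketSort n key i ++ (List.range n).filter (key · = i) := by
  simp [bucketSort, List.range_succ]

theorem nodup_bucketSort (n : ℕ) (key : ℕ → ℕ) (i : ℕ) : (bucketSort n key i).Nodup := by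
  induction i with
  | zero => simp [bucketSort]
  | succ i ih =>
    rw [bucketSort_succ, List.nodup_append]
    refine ⟨ih, List.nodup_range.filter _, ?_⟩
    rintro x hx y hy rfl
    rw [mem_bucketSort] at hx
    simp only [List.mem_filter, decide_eq_true_eq] at hy
    omega

theorem pairwise_bucketSort (n : ℕ) (key : ℕ → ℕ) (i : ℕ) :
    (bucketSort n key i).Pairwise fun x y => key x ≤ key y := by
  induction i with
  | zero => simp [bucketSort]
  | succ i ih =>
    rw [bucketSort_succ, List.pairwise_append]
    refine ⟨ih, ?_, ?_⟩
    · refine List.pairwise_of_forall_mem_list ?_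
      intro x hx y hy
      simp only [List.mem_filter, decide_eq_true_eq] at hx hy
      omega
    · intro x hx y hy
      rw [mem_bucketSort] at hx
      simp only [List.mem_filter, decide_eq_true_eq] at hy
      omega

theorem length_bucketSort_le (n : ℕ) (key : ℕ → ℕ) (i : ℕ) : (bucketSort n key i).length ≤ n := by
  have h := (nodup_bucketSort n key i).subperm
    (l₂ := List.range n) fun x hx => List.mem_range.2 (mem_bucketSort.1 hx).1
  simpa using h.length_le

/-- Buckets are emptied in increasing order, and pushing to the front makes each class decreasing.
The budget is four units per entry and four per bucket, with `n + 2` buckets because of the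
sentinels. -/
theorem sortLoop_spec {n S W : ℕ} {lab key : ℕ → ℕ} (hlab : ∀ i < n, lab i ≤ n)
    (hS : n + 1 < S) (hW : n + 2 ≤ W) {c : Cfg} (hn : c.nX = n) (hcl : c.lab = lab) (hi : c.i = 0)
    (hch : c.ch = fun _ => 0)
    (hbn : ∀ b, Linked c.bn (c.bh b) ((List.range n).filter (key · = b))) :
    ∃ q ch cn, Silent S W sortLoop c.store (8 * n + 9)
        { c with i := n + 2, q := q, ch := ch, cn := cn }.store ∧
      ∀ b, Linked cn (ch b) ((bucketSort n key (n + 2)).reverse.filter (lab · = b)) := by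
  have key := Silent.while (S := S) (W := W) (e := .reg 3) (f := .plus (.reg 0) (.const 2))
    (b := .seq (.assign 4 (.read 4 (.reg 3)))
      (.seq drainLoop (.assign 3 (.plus (.reg 3) (.const 1)))))
    (fun m c' => ∃ i q ch cn, c' = { c with i := i, q := q, ch := ch, cn := cn } ∧ i ≤ n + 2 ∧
      (∀ b, Linked cn (ch b) ((bucketSort n key i).reverse.filter (lab · = b))) ∧
      m = 4 * (n - (bucketSort n key i).length) + 4 * (n + 2 - i))
    (by
      rintro m c' ⟨i, q, ch, cn, rfl, hin, hl, rfl⟩ hg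
      have hin' : i < n + 2 := by
        have : i < c.nX + 2 := hg
        omega
      have hbucket : c.bh i ≤ W := by
        have := hbn i
        rcases hb : (List.range n).filter (key · = i) with _ | ⟨y, l'⟩
        · rw [hb] at this
          rw [show c.bh i = 0 from this]
          omega
        · have hy : y ∈ (List.range n).filter (key · = i) := by rw [hb]; simp
          rw [hb] at this
          rw [this.1]
          simp only [List.mem_filter, List.mem_range] at hy
          omega
      have hsucc := bucketSort_succ n key i
      obtain ⟨ch', cn', h1, h2⟩ := drainLoop_spec (S := S) (W := W) (n := n) hlab hS (by omega)
        (c := { c with i := i, q := c.bh i, ch := ch, cn := cn }) hcl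
        (l := bucketSort n key i) (rest := (List.range n).filter (key · = i))
        (hsucc ▸ nodup_bucketSort n key (i + 1))
        (fun x hx => (mem_bucketSort.1 (hsucc.symm ▸ hx : x ∈ bucketSort n key (i + 1))).1)
        hl (hbn i)
      rw [← hsucc] at h2
      have s1 : Silent S W (.assign 4 (.read 4 (.reg 3)))
          ({ c with i := i, q := q, ch := ch, cn := cn } : Cfg).store 1
          ({ c with i := i, q := c.bh i, ch := ch, cn := cn } : Cfg).store :=
        Silent.assign_q (c := { c with i := i, q := q, ch := ch, cn := cn }) rfl hbucket
      have s3 : Silent S W (.assign 3 (.plus (.reg 3) (.const 1)))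
          ({ c with i := i, q := 0, ch := ch', cn := cn' } : Cfg).store 1
          ({ c with i := i + 1, q := 0, ch := ch', cn := cn' } : Cfg).store :=
        Silent.assign_i (c := { c with i := i, q := 0, ch := ch', cn := cn' }) rfl (by omega)
      refine ⟨_, _, _, s1.seq (h1.seq s3), ⟨i + 1, 0, ch', cn', rfl, by omega, h2, rfl⟩, ?_⟩
      have h5 := length_bucketSort_le n key (i + 1)
      rw [hsucc, List.length_append] at h5 ⊢
      omega)
    (c := c) ⟨0, c.q, c.ch, c.cn, by rw [← hi], by omega, by simp [bucketSort, hch, Linked], rfl⟩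
  obtain ⟨c', m', h1, ⟨i, q, ch, cn, rfl, h2, h3, -⟩, h5⟩ := key
  obtain rfl : i = n + 2 := by
    have : ¬ i < c.nX + 2 := h5
    omega
  exact ⟨q, ch, cn, h1.mono (by simp [bucketSort]; omega), h3⟩

/-- The preprocessing: sort the label classes and find the first solution candidate. -/
def prepare : Prog :=
  .seq (.write 0 (.reg 0) (.reg 1))
    (.seq (.write 0 (.plus (.reg 0) (.const 1)) (.plus (.reg 1) (.const 1)))
      (.seq (.write 3 (.reg 0) (.plus (.reg 0) (.const 1)))
        (.seq (.assign 3 (.reg 0))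
          (.seq bucketLoop
            (.seq (.assign 3 (.const 0))
              (.seq sortLoop
                (.seq (.write 8 (.plus (.reg 2) (.const 1)) (.reg 0))
                  (.seq (.write 8 (.reg 2) (.minus (.read 6 (.reg 2)) (.const 1)))
                    (.assign 6 (.reg 2))))))))))

/-- The sentinel index `n` is placed at level `a + 1` of the solution array as an artificial
successor of the last vertex, and the head of class `a` at level `a`. The outermost loop can then be
run like every inner loop. -/
theorem prepare_spec {n ny a S W : ℕ} {lf₀ lf rt lab : ℕ → ℕ}
    (h : SortedIntervals n ny lf rt lab)
    (hlf : lf = Function.update (Function.update lf₀ n ny) (n + 1) (ny + 1))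
    (hS : n + 1 < S) (hW : n + ny + 2 ≤ W) (ha : a < n) {c : Cfg} (hn : c.nX = n) (hny : c.nY = ny)
    (hca : c.a = a) (hclf : c.lf = lf₀) (hrt : c.rt = rt) (hlab : c.lab = lab)
    (hbh : c.bh = fun _ => 0) (hch : c.ch = fun _ => 0) :
    ∃ c' : Cfg, Silent S W prepare c.store
        (∑ j ∈ Finset.range n, (2 * (rt j + 2 - lf j) + 8) + 8 * n + 18) c'.store ∧
      c'.a = a ∧ c'.mode = c.mode ∧ c'.d = a ∧ c'.lf = lf ∧ c'.rt = rt ∧ c'.sol (a + 1) = n ∧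
      c'.sol a = c'.ch a - 1 ∧
      ∀ b, Linked c'.cn (c'.ch b)
        ((bucketSort n (bucketOf lf rt) (n + 2)).reverse.filter (lab · = b)) := by
  let c1 : Cfg := { c with lf := Function.update c.lf n ny }
  let c2 : Cfg := { c1 with lf := Function.update c1.lf (n + 1) (ny + 1) }
  let c3 : Cfg := { c2 with nxt := Function.update c2.nxt n (n + 1) }
  let c4 : Cfg := { c3 with i := n }
  have s1 : Silent S W (.write 0 (.reg 0) (.reg 1)) c.store 1 c1.store :=
    Silent.write_lf hn (by omega) hny (by omega)
  have s2 : Silent S W (.write 0 (.plus (.reg 0) (.const 1)) (.plus (.reg 1) (.const 1)))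
      c1.store 1 c2.store :=
    Silent.write_lf (c := c1) (congrArg (· + 1) hn) (by omega) (congrArg (· + 1) hny) (by omega)
  have s3 : Silent S W (.write 3 (.reg 0) (.plus (.reg 0) (.const 1))) c2.store 1 c3.store :=
    Silent.write_nxt (c := c2) hn (by omega) (congrArg (· + 1) hn) (by omega)
  have s4 : Silent S W (.assign 3 (.reg 0)) c3.store 1 c4.store :=
    Silent.assign_i (c := c3) hn (by omega)
  have hlf4 : c4.lf = lf := by
    rw [hlf, ← hclf]
  obtain ⟨q, nxt, bh, bn, s5, hb⟩ := bucketLoop_spec h hS (by omega : n + 1 ≤ W) (c := c4) hlf4 hrt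
    rfl (Function.update_self _ _ _) hbh
  let c5 : Cfg := { c4 with i := 0, q := q, nxt := nxt, bh := bh, bn := bn }
  have s6 : Silent S W (.assign 3 (.const 0)) c5.store 1 c5.store :=
    Silent.assign_i (c := c5) rfl (by omega)
  obtain ⟨q', ch, cn, s7, hl⟩ := sortLoop_spec (S := S) (W := W) (n := n) h.lab_le hS (by omega)
    (c := c5) hn hlab rfl hch hb
  let c7 : Cfg := { c5 with i := n + 2, q := q', ch := ch, cn := cn }
  let c8 : Cfg := { c7 with sol := Function.update c7.sol (a + 1) n }
  let c9 : Cfg := { c8 with sol := Function.update c8.sol a (ch a - 1) }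
  let c10 : Cfg := { c9 with d := a }
  have s8 : Silent S W (.write 8 (.plus (.reg 2) (.const 1)) (.reg 0)) c7.store 1 c8.store :=
    Silent.write_sol (c := c7) (congrArg (· + 1) hca) (by omega) hn (by omega)
  have hcha : ch a - 1 ≤ W := by
    have := hl a
    rcases hb : (bucketSort n (bucketOf lf rt) (n + 2)).reverse.filter (lab · = a) with _ | ⟨y, l'⟩
    · rw [hb] at this
      rw [show ch a = 0 from this]
      omega
    · have hy : y ∈ (bucketSort n (bucketOf lf rt) (n + 2)).reverse.filter (lab · = a) := by
        rw [hb]; simp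
      rw [hb] at this
      rw [this.1]
      simp only [List.mem_filter, List.mem_reverse, mem_bucketSort] at hy
      omega
  have s9 : Silent S W (.write 8 (.reg 2) (.minus (.read 6 (.reg 2)) (.const 1)))
      c8.store 1 c9.store := by
    refine Silent.write_sol (c := c8) hca (by omega) ?_ hcha
    change ch c.a - 1 = _
    rw [hca]
  have s10 : Silent S W (.assign 6 (.reg 2)) c9.store 1 c10.store :=
    Silent.assign_d (c := c9) hca (by omega)
  refine ⟨c10, ?_, hca, rfl, rfl, hlf4, hrt, ?_, Function.update_self _ _ _, hl⟩
  · exact (s1.seq (s2.seq (s3.seq (s4.seq (s5.seq (s6.seq (s7.seq (s8.seq (s9.seq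
      s10))))))))).mono (by omega)
  · change Function.update c8.sol a (ch a - 1) (a + 1) = n
    rw [Function.update_of_ne (by omega)]
    exact Function.update_self _ _ _

end Sorting

-- Depth first search without a recursion stack

section Enumeration

/-! ### The enumeration loop -/

/-- `t` is the trace of some iterations of `while e < f do b` that lead from one store to
another. -/
inductive Iter (S W : ℕ) (e f : RExpr) (b : Prog) :
    Store → List (Option (List ℕ)) → Store → Prop
  | refl (s : Store) : Iter S W e f b s [] s
  | step {s s' s'' : Store} {t t' : List (Option (List ℕ))} (hg : e.eval s < f.eval s)
      (hb : Exec S W b s t s') (h : Iter S W e f b s' t' s'') :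
      Iter S W e f b s (none :: (t ++ t')) s''

namespace Iter

variable {S W T : ℕ} {e f : RExpr} {b : Prog} {s s' s'' : Store} {t t' : List (Option (List ℕ))}

theorem trans (h : Iter S W e f b s t s') (h' : Iter S W e f b s' t' s'') :
    Iter S W e f b s (t ++ t') s'' := by
  induction h with
  | refl s => exact h'
  | step hg hb _ ih =>
    have := Iter.step hg hb (ih h')
    simpa using this

theorem exec_while (h : Iter S W e f b s t s') (hg : ¬ e.eval s' < f.eval s') :
    Exec S W (.whileLt e f b) s (t ++ [none]) s' := by
  induction h with
  | refl s => exact .whileFalse _ _ _ _ hg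
  | step hg' hb _ ih =>
    have := Exec.whileTrue _ _ _ _ _ _ _ _ hg' hb (ih hg)
    simpa using this

theorem single (hg : e.eval s < f.eval s) (hb : Exec S W b s t s') :
    Iter S W e f b s (none :: t) s' := by
  simpa using Iter.step hg hb (.refl s')

theorem of_silent (hg : e.eval s < f.eval s) (hb : Silent S W b s T s') :
    ∃ t, t.reduceOption = [] ∧ t.length ≤ T + 1 ∧ Iter S W e f b s t s' := by
  obtain ⟨m, hm, hb⟩ := hb
  exact ⟨_, by simp [List.reduceOption_cons_of_none, List.reduceOption_replicate_none],
    by simpa using hm, .single hg hb⟩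

end Iter

/-- Go to the first candidate of the current vertex, or print the solution. -/
def descendStep : Prog :=
  .ifLt (.const 0) (.reg 6)
    (.seq (.assign 6 (.minus (.reg 6) (.const 1)))
      (.write 8 (.reg 6) (.minus (.read 6 (.reg 6)) (.const 1))))
    (.seq (.print 8 (.plus (.reg 2) (.const 1))) (.assign 5 (.const 1)))

/-- Go to the next candidate at the current level, or to the level above. -/
def ascendStep : Prog :=
  .ifLt (.const 0) (.read 7 (.read 8 (.reg 6)))
    (.ifLt (.read 0 (.read 8 (.plus (.reg 6) (.const 1))))
      (.plus (.read 1 (.minus (.read 7 (.read 8 (.reg 6))) (.const 1))) (.const 2))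
      (.seq (.write 8 (.reg 6) (.minus (.read 7 (.read 8 (.reg 6))) (.const 1)))
        (.assign 5 (.const 0)))
      (.assign 6 (.plus (.reg 6) (.const 1))))
    (.assign 6 (.plus (.reg 6) (.const 1)))

/-- One step of the depth first search. -/
def enumBody : Prog := .ifLt (.reg 5) (.const 1) descendStep ascendStep

/-- The iterations of the depth first search. -/
abbrev EnumIter (S W : ℕ) : Store → List (Option (List ℕ)) → Store → Prop :=
  Iter S W (.reg 6) (.plus (.reg 2) (.const 1)) enumBody

/-- The store of the depth first search in a given mode (`0` for descending, `1` for ascending),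
at a given level and with a given partial solution. -/
def Cfg.at (c : Cfg) (mode d : ℕ) (sol : ℕ → ℕ) : Store :=
  ({ c with mode := mode, d := d, sol := sol } : Cfg).store

section Steps

variable {S W : ℕ} {c : Cfg} {d : ℕ} {f : ℕ → ℕ}

theorem enumIter_descend (hd : d < c.a) (hS : d < S) (hW : d ≤ W) (hc : c.ch d - 1 ≤ W) :
    ∃ t, t.reduceOption = [] ∧ t.length ≤ 6 ∧
      EnumIter S W (c.at 0 (d + 1) f) t (c.at 0 d (Function.update f d (c.ch d - 1))) := by
  have s1 : Silent S W (.assign 6 (.minus (.reg 6) (.const 1))) (c.at 0 (d + 1) f) 1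
      (c.at 0 d f) :=
    Silent.assign_d (c := { c with mode := 0, d := d + 1, sol := f }) rfl hW
  have s2 : Silent S W (.write 8 (.reg 6) (.minus (.read 6 (.reg 6)) (.const 1))) (c.at 0 d f) 1
      (c.at 0 d (Function.update f d (c.ch d - 1))) :=
    Silent.write_sol (c := { c with mode := 0, d := d, sol := f }) rfl hS rfl hc
  obtain ⟨t, h1, h2, h3⟩ := Iter.of_silent (e := .reg 6) (f := .plus (.reg 2) (.const 1))
    (b := enumBody) (s := c.at 0 (d + 1) f)
    (show d + 1 < c.a + 1 by omega)
    (Silent.ifTrue (show 0 < 1 by omega) (Silent.ifTrue (show 0 < d + 1 by omega) (s1.seq s2)))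
  exact ⟨t, h1, by omega, h3⟩

theorem enumIter_print (hW : 1 ≤ W) :
    ∃ m ≤ 1, EnumIter S W (c.at 0 0 f)
      ((none :: none :: none :: List.replicate (c.a + 1) none) ++
        [some ((List.range (c.a + 1)).map f)] ++ List.replicate m none) (c.at 1 0 f) := by
  have h1 : Exec S W (.print 8 (.plus (.reg 2) (.const 1))) (c.at 0 0 f)
      (List.replicate (c.a + 1) none ++ [some ((List.range (c.a + 1)).map f)]) (c.at 0 0 f) :=
    Exec.print 8 (.plus (.reg 2) (.const 1)) (c.at 0 0 f)
  obtain ⟨m, hm, h2⟩ : Silent S W (.assign 5 (.const 1)) (c.at 0 0 f) 1 (c.at 1 0 f) :=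
    Silent.assign_mode (c := { c with mode := 0, d := 0, sol := f }) rfl hW
  have h3 : Exec S W descendStep (c.at 0 0 f) _ (c.at 1 0 f) :=
    Exec.ifFalse (.const 0) (.reg 6) _ _ _ _ _ (show ¬ 0 < 0 by omega) (.seq _ _ _ _ _ _ _ h1 h2)
  have h4 : Exec S W enumBody (c.at 0 0 f) _ (c.at 1 0 f) :=
    Exec.ifTrue (.reg 5) (.const 1) _ _ _ _ _ (show 0 < 1 by omega) h3
  have := Iter.single (e := .reg 6) (f := .plus (.reg 2) (.const 1)) (s := c.at 0 0 f)
    (show 0 < c.a + 1 by omega) h4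
  exact ⟨m, hm, by simpa using this⟩

/-- This is the most expensive silent step: the loop guard, three tests and two writes account for
the common bound of `6` units. -/
theorem enumIter_next {y : ℕ} (hd : d ≤ c.a) (hS : d < S) (hyW : y ≤ W)
    (hy : c.cn (f d) = y + 1) (hv : c.lf (f (d + 1)) < c.rt y + 2) :
    ∃ t, t.reduceOption = [] ∧ t.length ≤ 6 ∧
      EnumIter S W (c.at 1 d f) t (c.at 0 d (Function.update f d y)) := by
  have e1 : c.cn (f d) - 1 = y := by omega
  have s1 : Silent S W (.write 8 (.reg 6) (.minus (.read 7 (.read 8 (.reg 6))) (.const 1)))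
      (c.at 1 d f) 1 (c.at 1 d (Function.update f d y)) :=
    Silent.write_sol (c := { c with mode := 1, d := d, sol := f }) rfl hS e1 hyW
  have s2 : Silent S W (.assign 5 (.const 0)) (c.at 1 d (Function.update f d y)) 1
      (c.at 0 d (Function.update f d y)) :=
    Silent.assign_mode (c := { c with mode := 1, d := d, sol := Function.update f d y }) rfl
      (Nat.zero_le _)
  obtain ⟨t, h1, h2, h3⟩ := Iter.of_silent (e := .reg 6) (f := .plus (.reg 2) (.const 1))
    (b := enumBody) (s := c.at 1 d f)
    (show d < c.a + 1 by omega)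
    (Silent.ifFalse (show ¬ 1 < 1 by omega) (Silent.ifTrue (show 0 < c.cn (f d) by omega)
      (Silent.ifTrue (show c.lf (f (d + 1)) < c.rt (c.cn (f d) - 1) + 2 by rwa [e1])
        (s1.seq s2))))
  exact ⟨t, h1, by omega, h3⟩

theorem enumIter_up (hd : d ≤ c.a) (hW : d + 1 ≤ W)
    (hy : ∀ y, c.cn (f d) = y + 1 → ¬ c.lf (f (d + 1)) < c.rt y + 2) :
    ∃ t, t.reduceOption = [] ∧ t.length ≤ 6 ∧
      EnumIter S W (c.at 1 d f) t (c.at 1 (d + 1) f) := by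
  have s1 : Silent S W (.assign 6 (.plus (.reg 6) (.const 1))) (c.at 1 d f) 1
      (c.at 1 (d + 1) f) :=
    Silent.assign_d (c := { c with mode := 1, d := d, sol := f }) rfl hW
  have s2 : Silent S W ascendStep (c.at 1 d f) 3 (c.at 1 (d + 1) f) := by
    by_cases hpos : 0 < c.cn (f d)
    · refine Silent.ifTrue (show 0 < c.cn (f d) from hpos) (Silent.ifFalse ?_ s1)
      exact hy (c.cn (f d) - 1) (by omega)
    · exact Silent.mono (T := 2) (Silent.ifFalse hpos s1) (by omega)
  obtain ⟨t, h1, h2, h3⟩ := Iter.of_silent (e := .reg 6) (f := .plus (.reg 2) (.const 1))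
    (b := enumBody) (s := c.at 1 d f)
    (show d < c.a + 1 by omega)
    (Silent.ifFalse (show ¬ 1 < 1 by omega) s2)
  exact ⟨t, h1, by omega, h3⟩

end Steps

variable {nX nY : ℕ} {G : SimpleGraph (Fin nX ⊕ Fin nY)} {L : Fin nX → ℕ∞}

theorem Prints.append {t t' : List (Option (List ℕ))} {Ds Ds' : List (Finset (Fin nX))}
    (h : Prints t Ds) (h' : Prints t' Ds') : Prints (t ++ t') (Ds ++ Ds') := by
  unfold Prints at *
  rw [List.reduceOption_append, List.map_append, List.map_append, h, h']

theorem prints_nil {t : List (Option (List ℕ))} (ht : t.reduceOption = []) :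
    Prints t ([] : List (Finset (Fin nX))) := by
  simp [Prints, ht]

/-- The arrays of `c` describe the graph and the sorted label classes. -/
structure EnumReady (G : SimpleGraph (Fin nX ⊕ Fin nY)) (L : Fin nX → ℕ∞) (a : ℕ) (c : Cfg) :
    Prop where
  a_eq : c.a = a
  lf_eq : ∀ x : Fin nX, c.lf x = left G x
  rt_eq : ∀ x : Fin nX, c.rt x = right G x
  last : c.lf nX = nY
  classes : ∀ d ≤ a, ∃ l : List (Fin nX), Linked c.cn (c.ch d) (l.map Fin.val) ∧ l.Nodup ∧
    (∀ x, x ∈ l ↔ L x = d) ∧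
    l.Pairwise fun x y : Fin nX => ∀ j ≤ nX, c.lf j < c.rt y + 2 → c.lf j < c.rt x + 2

/-- The set `D` consists of the entries of `f` from level `d` to level `a`. -/
def SolSet (a d : ℕ) (D : Finset (Fin nX)) (f : ℕ → ℕ) : Prop :=
  ∀ j, (∃ x ∈ D, x.val = j) ↔ ∃ i, d ≤ i ∧ i ≤ a ∧ f i = j

theorem SolSet.congr {a d : ℕ} {D : Finset (Fin nX)} {f f' : ℕ → ℕ} (h : SolSet a d D f)
    (hf : ∀ i, d ≤ i → f' i = f i) : SolSet a d D f' := by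
  intro j
  rw [h j]
  exact exists_congr fun i => and_congr_right fun hi => by rw [hf i hi]

theorem SolSet.insert {a d : ℕ} {D : Finset (Fin nX)} {f : ℕ → ℕ} (h : SolSet a (d + 1) D f)
    (hd : d ≤ a) {x : Fin nX} (hx : f d = x) : SolSet a d (insert x D) f := by
  intro j
  simp only [Finset.mem_insert, exists_eq_or_imp, h j]
  constructor
  · rintro (rfl | ⟨i, h1, h2, h3⟩)
    · exact ⟨d, le_rfl, hd, hx⟩
    · exact ⟨i, by omega, h2, h3⟩
  · rintro ⟨i, h1, h2, h3⟩
    rcases h1.eq_or_lt with rfl | h1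
    · exact Or.inl (by rw [← hx, h3])
    · exact Or.inr ⟨i, h1, h2, h3⟩

/-- The hypothesis `hnode` simulates one call; chaining it along the class list simulates the loop
of the caller. A subsearch changes the solution only below level `d`, so the entry at level `d`
still leads to the next list element afterwards, and that at level `d + 1` is still the vertex to
test against. A gap is an ascent, one step and a descent with printing, which fits into `20 * (a +
1)`. -/
theorem enumIter_list {S W a d : ℕ} {c : Cfg} (hc : EnumReady G L a c) (hd : d ≤ a)
    (ha : a < nX) (hS : nX < S) (hW : nX + 1 ≤ W)
    (hnode : ∀ (x : Fin nX) (D : Finset (Fin nX)) (f : ℕ → ℕ), Tight G L d x → f d = x →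
      SolSet a d D f → ∃ f' t τ, EnumIter S W (c.at 0 d f) t (c.at 1 d f') ∧
        (∀ i, d ≤ i → f' i = f i) ∧ Generate G L D x τ ∧ Prints t (outputs τ) ∧
        Paced (6 * (d + 1) + a + 1) (6 * (d + 1)) (20 * (a + 1)) t)
    {x : Fin nX} {rest : List (Fin nX)} {D : Finset (Fin nX)} {f : ℕ → ℕ} (hf : f d = x)
    (hlink : Linked c.cn (c.cn x) (rest.map Fin.val)) (hD : SolSet a (d + 1) D f)
    (hj : f (d + 1) ≤ nX) (hx : Tight G L d x)
    (hv : ∀ y ∈ rest, c.lf (f (d + 1)) < c.rt y + 2 → Tight G L d y)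
    (hpw : rest.Pairwise fun x y : Fin nX => ∀ j ≤ nX, c.lf j < c.rt y + 2 → c.lf j < c.rt x + 2) :
    ∃ f' t τ, EnumIter S W (c.at 0 d f) t (c.at 1 (d + 1) f') ∧ (∀ i, d + 1 ≤ i → f' i = f i) ∧
      GenerateLoop G L D (x :: rest.filter fun y => c.lf (f (d + 1)) < c.rt y + 2) τ ∧
      Prints t (outputs τ) ∧ Paced (6 * (d + 1) + a + 1) (6 * (d + 2)) (20 * (a + 1)) t := by
  induction rest generalizing x f with
  | nil =>
    obtain ⟨f', t, τ, h1, h2, h3, h4, h5⟩ := hnode x _ f hx hf (hD.insert hd hf)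
    have hcn : c.cn (f' d) = 0 := by
      rw [h2 d le_rfl, hf]
      exact hlink
    obtain ⟨t', g1, g2, g3⟩ := enumIter_up (S := S) (W := W) (c := c) (d := d) (f := f')
      (hc.a_eq ▸ hd) (by omega) (fun y hy => by omega)
    refine ⟨f', t ++ t', τ ++ [], h1.trans g3, fun i hi => h2 i (by omega),
      .cons _ _ _ _ _ h3 (.nil _), ?_, ?_⟩
    · rw [outputs_append]
      exact h4.append (prints_nil g1)
    · exact h5.append_silent g1 g2 (by omega)
  | cons y rest ih =>
    obtain ⟨f', t, τ, h1, h2, h3, h4, h5⟩ := hnode x _ f hx hf (hD.insert hd hf)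
    have hcn : c.cn (f' d) = y + 1 := by
      rw [h2 d le_rfl, hf]
      exact hlink.1
    have hf' : f' (d + 1) = f (d + 1) := h2 _ (by omega)
    rw [List.pairwise_cons] at hpw
    by_cases hy : c.lf (f (d + 1)) < c.rt y + 2
    · obtain ⟨t', g1, g2, g3⟩ := enumIter_next (S := S) (W := W) (c := c) (d := d) (f := f') (y := y)
        (hc.a_eq ▸ hd) (by omega) (by omega) hcn (by rwa [hf'])
      have hf'' : Function.update f' d (y : ℕ) (d + 1) = f (d + 1) := by
        rw [Function.update_of_ne (by omega), hf']
      have hup : ∀ i, d + 1 ≤ i → Function.update f' d (y : ℕ) i = f i := by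
        intro i hi
        rw [Function.update_of_ne (by omega), h2 i (by omega)]
      obtain ⟨f'', t'', τ', k1, k2, k3, k4, k5⟩ := ih (x := y) (f := Function.update f' d y)
        (Function.update_self _ _ _) hlink.2 (hD.congr hup) (by rwa [hf''])
        (hv y (by simp) hy) (by rw [hf'']; exact fun z hz => hv z (by simp [hz])) hpw.2
      rw [hf''] at k3
      refine ⟨f'', t ++ t' ++ t'', τ ++ τ', (h1.trans g3).trans k1,
        fun i hi => (k2 i hi).trans (hup i hi), ?_, ?_, ?_⟩
      · rw [List.filter_cons_of_pos (by simpa using hy)]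
        exact .cons _ _ _ _ _ h3 k3
      · rw [outputs_append]
        have := (h4.append (prints_nil g1)).append k4
        simpa using this
      · exact (h5.append_silent g1 g2 (by omega)).append k5 (by omega)
    · obtain ⟨t', g1, g2, g3⟩ := enumIter_up (S := S) (W := W) (c := c) (d := d) (f := f')
        (hc.a_eq ▸ hd) (by omega) (fun z hz => by
          obtain rfl : z = y := by omega
          rwa [hf'])
      -- The class is sorted, so after the first failing test all later entries fail too.
      have hfil : ((y :: rest).filter fun y : Fin nX => c.lf (f (d + 1)) < c.rt y + 2) = [] := by
        rw [List.filter_eq_nil_iff]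
        intro z hz
        simp only [decide_eq_true_eq]
        rcases List.mem_cons.1 hz with rfl | hz
        · exact hy
        · exact fun h => hy (hpw.1 z hz _ hj h)
      rw [hfil]
      refine ⟨f', t ++ t', τ ++ [], h1.trans g3, fun i hi => h2 i (by omega),
        .cons _ _ _ _ _ h3 (.nil _), ?_, ?_⟩
      · rw [outputs_append]
        exact h4.append (prints_nil g1)
      · exact h5.append_silent g1 g2 (by omega)

/-- The traversal of the valid part of a label class. -/
theorem enumIter_class {S W a d : ℕ} {c : Cfg} (hc : EnumReady G L a c) (hd : d ≤ a)
    (ha : a < nX) (hS : nX < S) (hW : nX + 1 ≤ W)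
    (hnode : ∀ (x : Fin nX) (D : Finset (Fin nX)) (f : ℕ → ℕ), Tight G L d x → f d = x →
      SolSet a d D f → ∃ f' t τ, EnumIter S W (c.at 0 d f) t (c.at 1 d f') ∧
        (∀ i, d ≤ i → f' i = f i) ∧ Generate G L D x τ ∧ Prints t (outputs τ) ∧
        Paced (6 * (d + 1) + a + 1) (6 * (d + 1)) (20 * (a + 1)) t)
    {D : Finset (Fin nX)} {f : ℕ → ℕ} (hf : f d = c.ch d - 1) (hD : SolSet a (d + 1) D f)
    (hj : f (d + 1) ≤ nX)
    (hne : ∃ y, L y = d ∧ c.lf (f (d + 1)) < c.rt y + 2)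
    (hv : ∀ y, L y = d → c.lf (f (d + 1)) < c.rt y + 2 → Tight G L d y) :
    c.ch d ≤ nX ∧ ∃ f' t l τ, EnumIter S W (c.at 0 d f) t (c.at 1 (d + 1) f') ∧
      (∀ i, d + 1 ≤ i → f' i = f i) ∧ l.Nodup ∧
      (∀ y, y ∈ l ↔ L y = d ∧ c.lf (f (d + 1)) < c.rt y + 2) ∧
      GenerateLoop G L D l τ ∧ Prints t (outputs τ) ∧
      Paced (6 * (d + 1) + a + 1) (6 * (d + 2)) (20 * (a + 1)) t := by
  obtain ⟨l, hlink, hnd, hmem, hpw⟩ := hc.classes d hd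
  obtain ⟨y, hy, hyv⟩ := hne
  rcases l with _ | ⟨x, rest⟩
  · exact absurd ((hmem y).2 hy) (by simp)
  rw [List.pairwise_cons] at hpw
  have hxv : c.lf (f (d + 1)) < c.rt x + 2 := by
    rcases List.mem_cons.1 ((hmem y).2 hy) with rfl | h
    · exact hyv
    · exact hpw.1 y h _ hj hyv
  have hch : c.ch d = x + 1 := hlink.1
  refine ⟨by omega, ?_⟩
  obtain ⟨f', t, τ, h1, h2, h3, h4, h5⟩ := enumIter_list hc hd ha hS hW hnode (x := x)
    (rest := rest) (by omega) hlink.2 hD hj (hv x ((hmem x).1 (by simp)) hxv)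
    (fun z hz => hv z ((hmem z).1 (by simp [hz]))) hpw.2
  refine ⟨f', t, _, τ, h1, h2, ?_, ?_, h3, h4, h5⟩
  · have := hnd.filter fun y : Fin nX => c.lf (f (d + 1)) < c.rt y + 2
    rwa [List.filter_cons_of_pos (by simpa using hxv)] at this
  · intro z
    rw [← hmem z]
    simp only [List.mem_cons, List.mem_filter, decide_eq_true_eq]
    constructor
    · rintro (rfl | ⟨h6, h7⟩)
      · exact ⟨Or.inl rfl, hxv⟩
      · exact ⟨Or.inr h6, h7⟩
    · rintro ⟨rfl | h6, h7⟩
      · exact Or.inl rfl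
      · exact Or.inr ⟨h6, h7⟩

/-- The level in the search is the label. Descending to the head of the class below needs no test:
some candidate exists, and the head passes every test that any entry passes. -/
theorem enumIter_node (hG : IsLexConvex G) (hL : IsLabelling G L) {S W a : ℕ} {c : Cfg}
    (hc : EnumReady G L a c) (ha : a < nX) (hS : nX < S) (hW : nX + 1 ≤ W) {d : ℕ} (hd : d ≤ a)
    (x : Fin nX) (D : Finset (Fin nX)) (f : ℕ → ℕ) (hx : Tight G L d x) (hf : f d = x)
    (hD : SolSet a d D f) :
    ∃ f' t τ, EnumIter S W (c.at 0 d f) t (c.at 1 d f') ∧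
      (∀ i, d ≤ i → f' i = f i) ∧ Generate G L D x τ ∧ Prints t (outputs τ) ∧
      Paced (6 * (d + 1) + a + 1) (6 * (d + 1)) (20 * (a + 1)) t := by
  induction d generalizing x D f with
  | zero =>
    obtain ⟨m, hm, hprint⟩ := enumIter_print (S := S) (W := W) (c := c) (f := f) (by omega)
    refine ⟨f, _, _, hprint, fun _ _ => rfl,
      .leaf D x (by simpa using hx.1), ?_, ?_⟩
    · have : ((List.range (c.a + 1)).map f).toFinset = D.map Fin.valEmbedding := by
        ext j
        have := hD j
        simp only [List.mem_toFinset, List.mem_map, List.mem_range, Finset.mem_map,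
          Fin.valEmbedding_apply, hc.a_eq]
        rw [this]
        exact exists_congr fun i => by
          constructor
          · rintro ⟨h1, h2⟩; exact ⟨by omega, by omega, h2⟩
          · rintro ⟨-, h1, h2⟩; exact ⟨by omega, h2⟩
      simp [Prints, outputs, List.filterMap_cons, Event.output?, List.reduceOption_append,
        List.reduceOption_replicate_none, this]
    · have h1 := ((((paced_singleton ((List.range (c.a + 1)).map f)).mono le_rfl le_rfl
        (Nat.zero_le (20 * (a + 1)))).silent_append
        (s := none :: none :: none :: List.replicate (c.a + 1) none) (m := a + 4)
        (by simp [List.reduceOption_replicate_none]) (by simp [hc.a_eq]) (by omega))).append_silent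
        (s := List.replicate m none) (m := 1) (by simp [List.reduceOption_replicate_none])
        (by simpa using hm) (by omega)
      exact h1.mono (by omega) (by omega) le_rfl
  | succ d ih =>
    have hval : ∀ y, L y = d → (c.lf (Function.update f d (c.ch d - 1) (d + 1)) < c.rt y + 2 ↔
        Arc G y x) := by
      intro y hy
      rw [Function.update_of_ne (by omega), hf, hc.lf_eq, hc.rt_eq, hx.arc_iff hG hL hy]
    obtain ⟨p, hp, hpd⟩ := hL.exists_arc hx.1
    obtain ⟨hch, f', t, l, τ, h1, h2, h3, h4, h5, h6, h7⟩ := enumIter_class hc (d := d) (by omega) ha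
      hS hW (fun x D f hx hf hD => ih (by omega) x D f hx hf hD) (D := D)
      (f := Function.update f d (c.ch d - 1)) (Function.update_self _ _ _)
      (hD.congr fun i hi => Function.update_of_ne (by omega) _ _)
      (by rw [Function.update_of_ne (by omega), hf]; omega)
      ⟨p, hpd, (hval p hpd).2 hp⟩
      (fun y hy hyv => hx.of_arc ((hval y hy).1 hyv) hy)
    obtain ⟨t', g1, g2, g3⟩ := enumIter_descend (S := S) (W := W) (c := c) (d := d) (f := f)
      (by rw [hc.a_eq]; omega) (by omega) (by omega) (by omega)
    refine ⟨f', t' ++ t, _, g3.trans h1, fun i hi => ?_, .node D x l τ ?_ h3 ?_ h5, ?_, ?_⟩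
    · rw [h2 i hi, Function.update_of_ne (by omega)]
    · rw [hx.1]
      norm_cast
    · intro y
      rw [h4, hG.candidate_iff_label hx.1]
      constructor
      · rintro ⟨k1, k2⟩
        exact ⟨(hval y k1).1 k2, k1⟩
      · rintro ⟨k1, k2⟩
        exact ⟨k2, (hval y k2).2 k1⟩
    · rw [outputs_node]
      have := (prints_nil g1).append h6
      simpa using this
    · exact (h7.silent_append g1 g2 (by omega)).mono (by omega) (by omega) le_rfl

/-- The depth first search. -/
def enumLoop : Prog := .whileLt (.reg 6) (.plus (.reg 2) (.const 1)) enumBody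

theorem enumLoop_spec (hG : IsLexConvex G) (hL : IsLabelling G L) {S W a : ℕ} {c : Cfg}
    (hc : EnumReady G L a c) (ha : a + 1 = mcrdCard G) (haX : a < nX) (hS : nX < S)
    (hW : nX + 1 ≤ W) (hmode : c.mode = 0) (hd : c.d = a) (hsol : c.sol a = c.ch a - 1)
    (hlast : c.sol (a + 1) = nX) :
    ∃ s t τ, Exec S W enumLoop c.store t s ∧ EnumRun G L a τ ∧ Prints t (outputs τ) ∧
      ∃ b, Paced (6 * (a + 1) + a + 1) b (20 * (a + 1)) t := by
  -- Against the sentinel with left end `nY`, the candidate test says exactly that the interval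
  -- reaches the last `Y`-vertex.
  have hval : ∀ y, L y = a → (c.lf (c.sol (a + 1)) < c.rt y + 2 ↔ Nbr G y (nY - 1)) := by
    intro y _
    rw [hlast, hc.last, hc.rt_eq, hG.nbr_last_iff]
    have := hG.right_lt y
    omega
  obtain ⟨p, hp, hpa⟩ := exists_last_label hG hL ha
  obtain ⟨-, f', t, l, τ, h1, -, h3, h4, h5, h6, h7⟩ := enumIter_class hc le_rfl haX hS hW
    (fun x D f hx hf hD => enumIter_node hG hL hc haX hS hW le_rfl x D f hx hf hD) (D := ∅)
    (f := c.sol) hsol (by intro j; simp; omega) hlast.le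
    ⟨p, hpa, (hval p hpa).2 hp⟩
    (fun y hy hyv => tight_of_last hG ha ((hval y hy).1 hyv) hy)
  have hstore : c.at 0 a c.sol = c.store := by
    rw [← hmode, ← hd]
    rfl
  rw [hstore] at h1
  refine ⟨_, t ++ [none], τ, h1.exec_while ?_, ⟨l, h3, fun y => ?_, h5⟩, ?_, _,
    h7.append_silent (m := 1) (by simp) (by simp) (by omega)⟩
  · change ¬ a + 1 < c.a + 1
    rw [hc.a_eq]
    omega
  · rw [h4]
    constructor
    · rintro ⟨k1, k2⟩
      exact ⟨(hval y k1).1 k2, k1⟩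
    · rintro ⟨k1, k2⟩
      exact ⟨k2, (hval y k2).2 k1⟩
  · have := h6.append (prints_nil (nX := nX) (t := [none]) (by simp))
    simpa using this

end Enumeration

-- The complete program and its resource bounds

section Program

variable {nX nY : ℕ} {G : SimpleGraph (Fin nX ⊕ Fin nY)} {L : Fin nX → ℕ∞}

/-! ### The program -/

/-- The enumeration program. -/
def enumProg : Prog := .seq prepare enumLoop

open Classical in
/-- The contents of the registers and arrays at the start. -/
noncomputable def inputCfg (G : SimpleGraph (Fin nX ⊕ Fin nY)) (L : Fin nX → ℕ∞) (a : ℕ) :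
    Cfg where
  nX := nX
  nY := nY
  a := a
  i := 0
  q := 0
  mode := 0
  d := 0
  lf i := if h : i < nX then left G ⟨i, h⟩ else 0
  rt i := if h : i < nX then right G ⟨i, h⟩ else 0
  lab i := if h : i < nX then (if L ⟨i, h⟩ = ⊤ then nX else (L ⟨i, h⟩).toNat) else 0
  nxt _ := 0
  bh _ := 0
  bn _ := 0
  ch _ := 0
  cn _ := 0
  sol _ := 0

theorem inputStore_eq (G : SimpleGraph (Fin nX ⊕ Fin nY)) (L : Fin nX → ℕ∞) (a : ℕ) :
    inputStore G L a = (inputCfg G L a).store := by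
  unfold inputStore Cfg.store
  congr 1
  · funext r
    rcases r with _ | _ | _ | r <;> try rfl
    simp only [show ¬ r + 1 + 1 + 1 = 0 by omega, show ¬ r + 1 + 1 + 1 = 1 by omega,
      show ¬ r + 1 + 1 + 1 = 2 by omega, if_false]
    rcases r with _ | _ | _ | _ | r <;> rfl
  · funext A
    rcases A with _ | _ | _ | A
    · funext i; simp [inputCfg]
    · funext i; simp [inputCfg]
    · funext i; simp [inputCfg]
    · simp only [show ¬ A + 1 + 1 + 1 = 0 by omega, show ¬ A + 1 + 1 + 1 = 1 by omega,
        show ¬ A + 1 + 1 + 1 = 2 by omega, if_false, dite_eq_ite, ite_self]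
      rcases A with _ | _ | _ | _ | _ | _ | A <;> rfl

/-- The array of the left ends, with two sentinels. -/
noncomputable def leftArray (G : SimpleGraph (Fin nX ⊕ Fin nY)) (L : Fin nX → ℕ∞) (a : ℕ) :
    ℕ → ℕ :=
  Function.update (Function.update (inputCfg G L a).lf nX nY) (nX + 1) (nY + 1)

theorem leftArray_coe (a : ℕ) (x : Fin nX) : leftArray G L a x = left G x := by
  have h1 : (x : ℕ) ≠ nX + 1 := by omega
  have h2 : (x : ℕ) ≠ nX := by omega
  simp [leftArray, inputCfg, h1, h2]

theorem leftArray_self (a : ℕ) : leftArray G L a nX = nY := by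
  simp [leftArray]

theorem rt_inputCfg (a : ℕ) (x : Fin nX) : (inputCfg G L a).rt x = right G x := by
  simp [inputCfg]

theorem lab_inputCfg_le (hL : IsLabelling G L) (a : ℕ) {i : ℕ} (hi : i < nX) :
    (inputCfg G L a).lab i ≤ nX := by
  simp only [inputCfg, hi, dite_true]
  split_ifs with h
  · exact le_rfl
  · lift L ⟨i, hi⟩ to ℕ using h with n hn
    simpa using (hL.label_lt hn.symm).le

/-- The condition `d < nX` excludes the code `nX` for an infinite label. -/
theorem lab_inputCfg_eq_iff (a : ℕ) {d : ℕ} (hd : d < nX) (x : Fin nX) :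
    (inputCfg G L a).lab x = d ↔ L x = d := by
  simp only [inputCfg, x.2, dite_true, Fin.eta]
  split_ifs with h
  · simp only [h, ENat.top_ne_natCast, iff_false]
    omega
  · lift L x to ℕ using h with n hn
    simp

theorem IsLexConvex.sortedIntervals (hG : IsLexConvex G) (hL : IsLabelling G L) (a : ℕ) :
    SortedIntervals nX nY (leftArray G L a) (inputCfg G L a).rt (inputCfg G L a).lab where
  last := leftArray_self a
  sentinel := by simp [leftArray]
  le_succ i hi := by
    rcases hi.eq_or_lt with rfl | hi
    · rw [leftArray_self]
      simp [leftArray]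
    · have h1 := leftArray_coe (G := G) (L := L) a ⟨i, hi⟩
      dsimp only at h1
      rw [h1]
      rcases (Nat.succ_le_of_lt hi).eq_or_lt with h2 | h2
      · rw [← Nat.succ_eq_add_one, h2, leftArray_self]
        exact (hG.nbr_left _).lt.le
      · have h3 := leftArray_coe (G := G) (L := L) a ⟨i + 1, h2⟩
        dsimp only at h3
        rw [h3]
        exact hG.left_mono (by simp)
  le i hi := by
    have h1 := leftArray_coe (G := G) (L := L) a ⟨i, hi⟩
    have h2 := rt_inputCfg (G := G) (L := L) a ⟨i, hi⟩
    dsimp only at h1 h2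
    rw [h1, h2]
    exact hG.left_le_right _
  lt i hi := by
    have h2 := rt_inputCfg (G := G) (L := L) a ⟨i, hi⟩
    dsimp only at h2
    rw [h2]
    exact hG.right_lt _
  lab_le i hi := lab_inputCfg_le hL a hi

theorem IsLexConvex.sum_length_le (hG : IsLexConvex G) :
    ∑ x : Fin nX, (right G x + 1 - left G x) ≤ G.edgeSet.ncard := by
  classical
  have h1 : ∑ x : Fin nX, (right G x + 1 - left G x) =
      (Finset.univ.sigma fun x : Fin nX => Finset.Icc (left G x) (right G x)).card := by
    simp
  rw [h1, Set.ncard_eq_toFinset_card _ G.edgeSet.toFinite]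
  have hmem : ∀ p ∈ Finset.univ.sigma fun x : Fin nX => Finset.Icc (left G x) (right G x),
      Nbr G p.1 p.2 := by
    intro p hp
    simp only [Finset.mem_sigma, Finset.mem_Icc] at hp
    exact hG.nbr_iff.2 hp.2
  refine Finset.card_le_card_of_injOn
    -- The second branch is a dummy: every pair that is counted has `p.2 < nY`.
    (fun p => if h : p.2 < nY then s(Sum.inl p.1, Sum.inr ⟨p.2, h⟩) else s(Sum.inl p.1, Sum.inl p.1))
    ?_ ?_
  · intro p hp
    obtain ⟨h, hadj⟩ := hmem p hp
    simpa [h] using hadj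
  · rintro ⟨x, j⟩ hp ⟨x', j'⟩ hp' he
    have h := (hmem _ hp).lt
    have h' := (hmem _ hp').lt
    dsimp only at h h'
    simp only [h, h', dite_true, Sym2.eq_iff, Sum.inl.injEq, Sum.inr.injEq, Fin.mk.injEq,
      reduceCtorEq, and_false, or_false] at he
    obtain ⟨rfl, rfl⟩ := he
    rfl

theorem exists_fin_list {n : ℕ} {l : List ℕ} (h : ∀ x ∈ l, x < n) :
    ∃ l' : List (Fin n), l'.map Fin.val = l :=
  ⟨l.pmap (fun x hx => ⟨x, hx⟩) h, by simp [List.map_pmap]⟩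

theorem Paced.delayAtMost {a b B : ℕ} {s t : List (Option (List ℕ))} (h : Paced a b B t)
    (hs : s.reduceOption = []) : DelayAtMost B (s ++ t) := by
  intro u v w e hu hv
  rw [List.append_assoc] at e
  rcases List.append_eq_append_iff.1 e with ⟨r, rfl, hr⟩ | ⟨r, rfl, -⟩
  · exact h.4 r v w (by rw [hr, List.append_assoc]) hv
  · rw [List.reduceOption_append, List.append_eq_nil_iff] at hs
    exact absurd hs.1 hu

theorem enumProg_spec (hG : IsLexConvex G) (hL : IsLabelling G L) {a : ℕ}
    (ha : a + 1 = mcrdCard G) :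
    ∃ (t : List (Option (List ℕ))) (s : Store) (τ : List (Event nX)),
      Exec (60 * nX) (60 * (nX + nY)) enumProg (inputStore G L a) t s ∧ EnumRun G L a τ ∧
      Prints t (outputs τ) ∧ FirstOutputWithin (60 * (nX + G.edgeSet.ncard)) t ∧
      DelayAtMost (60 * mcrdCard G) t := by
  have hX := hG.nonemptyX
  have haX : a < nX := by
    obtain ⟨x, -, hx⟩ := exists_last_label hG hL ha
    exact hL.label_lt hx
  have hsort := hG.sortedIntervals hL a
  obtain ⟨c, ⟨m, hm, h1⟩, hca, hcm, hcd, hclf, hcrt, hcs, hcs', hcl⟩ :=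
    prepare_spec (S := 60 * nX) (W := 60 * (nX + nY)) hsort rfl (by omega) (by omega) haX
      (c := inputCfg G L a) rfl rfl rfl rfl rfl rfl rfl rfl
  have hready : EnumReady G L a c := by
    refine ⟨hca, fun x => ?_, fun x => ?_, ?_, fun d hd => ?_⟩
    · rw [hclf, leftArray_coe]
    · rw [hcrt, rt_inputCfg]
    · rw [hclf, leftArray_self]
    · have hlt : ∀ x ∈ bucketSort nX (bucketOf (leftArray G L a) (inputCfg G L a).rt) (nX + 2),
          x < nX := fun x hx => (mem_bucketSort.1 hx).1
      obtain ⟨l, hl⟩ := exists_fin_list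
        (l := (bucketSort nX (bucketOf (leftArray G L a) (inputCfg G L a).rt)
          (nX + 2)).reverse.filter ((inputCfg G L a).lab · = d))
        fun x hx => hlt x (List.mem_reverse.1 (List.mem_filter.1 hx).1)
      refine ⟨l, hl ▸ hcl d, ?_, fun x => ?_, ?_⟩
      · refine List.Nodup.of_map Fin.val ?_
        rw [hl]
        exact (List.nodup_reverse.2 (nodup_bucketSort _ _ _)).filter _
      · rw [← List.mem_map_of_injective Fin.val_injective, hl, List.mem_filter, List.mem_reverse,
          mem_bucketSort, decide_eq_true_eq, lab_inputCfg_eq_iff a (by omega)]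
        have := hsort.bucketOf_le x.2
        exact ⟨fun h => h.2, fun h => ⟨⟨x.2, by omega⟩, h⟩⟩
      · have hpw : (l.map Fin.val).Pairwise fun x y =>
            bucketOf (leftArray G L a) (inputCfg G L a).rt y ≤
              bucketOf (leftArray G L a) (inputCfg G L a).rt x := by
          rw [hl]
          exact (List.pairwise_reverse.2 (pairwise_bucketSort _ _ _)).filter _
        refine (List.pairwise_map.1 hpw).imp ?_
        intro x y hxy j hj h
        rw [hclf, hcrt] at h ⊢
        rw [← hsort.lt_bucketOf_iff y.2 (by omega)] at h
        exact lt_of_lt_bucketOf (h.trans_le hxy)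
  obtain ⟨s, t, τ, h2, h3, h4, b, h5⟩ := enumLoop_spec (S := 60 * nX) (W := 60 * (nX + nY)) hG hL
    hready ha haX (by omega) (by omega) hcm hcd hcs' hcs
  have hsilent : (List.replicate m (none : Option (List ℕ))).reduceOption = [] :=
    List.reduceOption_replicate_none
  rw [inputStore_eq]
  refine ⟨_, _, τ, Exec.seq _ _ _ _ _ _ _ h1 h2, h3, ?_, ?_, ?_⟩
  · simpa using (prints_nil hsilent).append h4
  -- The walks cost twice the degrees plus a constant per vertex, and the degrees sum to at most the
  -- number of edges.
  · have htime : ∑ j ∈ Finset.range nX, (2 * ((inputCfg G L a).rt j + 2 - leftArray G L a j) + 8) ≤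
        2 * G.edgeSet.ncard + 10 * nX := by
      rw [Finset.sum_range]
      calc _ ≤ ∑ x : Fin nX, (2 * (right G x + 1 - left G x) + 10) := by
            refine Finset.sum_le_sum fun x _ => ?_
            rw [leftArray_coe, rt_inputCfg]
            omega
        _ ≤ _ := by
            rw [Finset.sum_add_distrib, ← Finset.mul_sum]
            have := hG.sum_length_le
            simp only [Finset.sum_const, Finset.card_univ, Fintype.card_fin, smul_eq_mul]
            omega
    have h6 := (h5.mono le_rfl le_rfl (Nat.le_add_left (20 * (a + 1)) (m + (6 * (a + 1) + a + 1)))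
      ).silent_append hsilent (m := m) (by simp) (Nat.le_add_right _ _)
    intro v w e hv
    have := h6.2 v w e hv
    omega
  · exact (h5.mono le_rfl le_rfl (by omega)).delayAtMost hsilent

end Program

end RedDom

theorem mainTheorem4 :
    ∃ (P : RedDom.Prog) (C : ℕ), ∀ (nX nY : ℕ) (G : SimpleGraph (Fin nX ⊕ Fin nY)),
      RedDom.IsLexConvex G →
      -- the labelling algorithm terminates
      (∃ L : Fin nX → ℕ∞, RedDom.LabelOutput G L) ∧
      ∀ L : Fin nX → ℕ∞, RedDom.LabelOutput G L →
        -- the smallest label of a neighbour of the last `Y`-vertex is `k - 1`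
        (⨅ x ∈ {x : Fin nX | RedDom.Nbr G x (nY - 1)}, L x) + 1 = (RedDom.mcrdCard G : ℕ∞) ∧
        -- the branch-and-bound algorithm terminates, whatever it outputs is correct
        (∃ τ, RedDom.EnumRun G L (RedDom.mcrdCard G - 1) τ) ∧
        (∀ τ, RedDom.EnumRun G L (RedDom.mcrdCard G - 1) τ →
          (RedDom.outputs τ).Nodup ∧
          (∀ D : Finset (Fin nX), D ∈ RedDom.outputs τ ↔ RedDom.IsMCRD G D) ∧
          RedDom.NoFailedPartialSolution τ ∧
          RedDom.CallDelayAtMost (C * RedDom.mcrdCard G) τ) ∧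
        -- it is implemented by `P` in linear space and linear delay
        ∃ (t : List (Option (List ℕ))) (s : RedDom.Store) (τ : List (RedDom.Event nX)),
          RedDom.Exec (C * nX) (C * (nX + nY)) P
            (RedDom.inputStore G L (RedDom.mcrdCard G - 1)) t s ∧
          RedDom.EnumRun G L (RedDom.mcrdCard G - 1) τ ∧
          RedDom.Prints t (RedDom.outputs τ) ∧
          RedDom.FirstOutputWithin (C * (nX + G.edgeSet.ncard)) t ∧
          RedDom.DelayAtMost (C * RedDom.mcrdCard G) t := by
  -- The constant `60` is generous; additive constants are absorbed because `nX` and `mcrdCard G`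
  -- are positive.
  refine ⟨RedDom.enumProg, 60, fun nX nY G hG => ⟨RedDom.exists_labelOutput hG, fun L hLab => ?_⟩⟩
  have hL := hLab.isLabelling hG
  have ha : RedDom.mcrdCard G - 1 + 1 = RedDom.mcrdCard G := Nat.sub_add_cancel hG.mcrdCard_pos
  obtain ⟨t, s, τ, h1, h2, h3⟩ := RedDom.enumProg_spec hG hL ha
  refine ⟨RedDom.iInf_label_add_one hG hL, ⟨τ, h2⟩, fun τ' hτ' => ?_, t, s, τ, h1, h2, h3⟩
  obtain ⟨k1, k2, k3, k4⟩ := hτ'.spec hG hL ha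
  exact ⟨k1, k2, k3, fun u v w e hv => (k4 u v w e hv).trans (Nat.mul_le_mul_right _ (by omega))⟩
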